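/- Let $0<m\le M$, $L,K\ge 0$, $\gamma_1>0$ and $T_0>0$. There is a constant $C$, depending only on $m,M,L,K,\gamma_1,T_0$, such that the following holds for every $T\in(0,T_0]$, with $\Omega_T:=\mathbb R\times(0,T]$. Let $g:\mathbb R\to\mathbb R$ be Lipschitz with constant $L$ and $m\le g\le M$, and let $\theta$ be a real function that is Hölder continuous with exponent $1/2$ and constant $K$ (with respect to $(x,t)$, for the metric $\max(|x-y|,|t-s|)$) on $\mathbb R\times[0,T]$. Let $\mathcal L:=\partial_t-g(\theta(x,t))\partial_{xx}+\gamma_1$, and let $\Gamma(x,t;\xi,\tau)$, $0\le\tau<t\le T$, be the kernel of $\mathcal L$ given by the parametrix method: with $$H^{\xi,\tau}(x-\xi,t-\tau)=\frac{1}{\sqrt{4\pi g(\theta(\xi,\tau))(t-\tau)}}\,e^{-\frac{(x-\xi)^2}{4g(\theta(\xi,\tau))(t-\tau)}},\qquad \mathcal K_0(x,t;\xi,\tau)=-\mathcal L_{(x,t)}H^{\xi,\tau}(x-\xi,t-\tau),$$ $$\mathcal K_{n+1}(x,t;\xi,\tau)=\int_\tau^t\int_{\mathbb R}\mathcal K_0(x,t;y,s)\,\mathcal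 K_n(y,s;\xi,\tau)\,dy\,ds,\qquad \Phi=\sum_{n\ge0}\mathcal K_n,$$ one sets $$\Gamma(x,t;\xi,\tau)=H^{\xi,\tau}(x-\xi,t-\tau)+\int_\tau^t\int_{\mathbb R}H^{y,s}(x-y,t-s)\,\Phi(y,s;\xi,\tau)\,dy\,ds .$$ The integrals defining $\mathcal K_n$ and $\Gamma$ and the series for $\Phi$ converge absolutely for all $x,\xi\in\mathbb R$ and $0\le\tau<t\le T$, and $\Gamma$ is differentiable in $x$ there; write $\Gamma_x$ for its derivative. Let $f\in L^2(\Omega_T)$ be real-valued. Then the integrals $$M_f(x,t):=\int_0^t\int_{\mathbb R}\Gamma(x,t;\xi,\tau)f(\xi,\tau)\,d\xi\,d\tau,\qquad M_{f,x}(x,t):=\int_0^t\int_{\mathbb R}\Gamma_x(x,t;\xi,\tau)f(\xi,\tau)\,d\xi\,d\tau$$ converge absolutely, the first for every and the second for almost every $(x,t)\in\Omega_T$; both are (almost everywhere equal to) measurable functions on $\Omega_T$, and $$\|M_f\|_{L^\infty(\Omega_T)}\le C\,T^{1/4}\|f\|_{L^2(\Omega_T)},\qquad \|M_{f,x}\|_{L^\infty(\Omega_T)}\le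 C\,T^{1/4}\|f\|_{L^\infty((0,T),L^2(\mathbb R))},$$ $$\|M_f\|_{L^2(\Omega_T)}\le C\,T\,\|f\|_{L^2(\Omega_T)},\qquad \|M_{f,x}\|_{L^2(\Omega_T)}\le C\,\sqrt T\,\|f\|_{L^2(\Omega_T)},$$ where the second estimate is void if $\|f\|_{L^\infty((0,T),L^2(\mathbb R))}=\infty$. -/

import Mathlib

open MeasureTheory Set
open scoped ENNReal NNReal

noncomputable section

namespace ParabolicKernel

/-- The heat kernel of `∂ₜ - a ∂ₓₓ` (constant `a > 0`), at position `x` and time `t > 0`. -/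
def heatKernel (a x t : ℝ) : ℝ :=
  (Real.sqrt (4 * Real.pi * a * t))⁻¹ * Real.exp (-x ^ 2 / (4 * a * t))

/-- The operator `w ↦ wₜ - a(x,t) wₓₓ + γ w`, applied to `w = w(x,t)`. -/
def parabolicOp (a : ℝ × ℝ → ℝ) (γ : ℝ) (w : ℝ → ℝ → ℝ) (x t : ℝ) : ℝ :=
  deriv (fun t' => w x t') t - a (x, t) * iteratedDeriv 2 (fun x' => w x' t) x + γ * w x t

/-- The parametrix `H^{ξ,τ}(x - ξ, t - τ)`: the heat kernel with the diffusion coefficient frozen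
at the source point `(ξ, τ)`. -/
def frozenKernel (a : ℝ × ℝ → ℝ) (x t ξ τ : ℝ) : ℝ :=
  heatKernel (a (ξ, τ)) (x - ξ) (t - τ)

/-- The error of the parametrix: minus the operator, in the variables `(x, t)`, applied to it. -/
def parametrixError (a : ℝ × ℝ → ℝ) (γ x t ξ τ : ℝ) : ℝ :=
  -parabolicOp a γ (fun x' t' => frozenKernel a x' t' ξ τ) x t

/-- The iterated kernels of the parametrix error under space-time convolution. -/
def iteratedError (a : ℝ × ℝ → ℝ) (γ : ℝ) : ℕ → ℝ → ℝ → ℝ → ℝ → ℝ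
  | 0, x, t, ξ, τ => parametrixError a γ x t ξ τ
  | n + 1, x, t, ξ, τ =>
      ∫ s in τ..t, ∫ y : ℝ, parametrixError a γ x t y s * iteratedError a γ n y s ξ τ

/-- The density `Φ` of the correction term, the solution
of `Φ = K + ∫∫ K Φ` (`K` the parametrix error) given by its Neumann series. -/
def density (a : ℝ × ℝ → ℝ) (γ x t ξ τ : ℝ) : ℝ :=
  ∑' n : ℕ, iteratedError a γ n x t ξ τ

/-- The kernel `Γ(x,t;ξ,τ)` (`t > τ`) of `∂ₜ - a ∂ₓₓ + γ` built by the parametrix method. -/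
def Gam (a : ℝ × ℝ → ℝ) (γ x t ξ τ : ℝ) : ℝ :=
  frozenKernel a x t ξ τ +
    ∫ s in τ..t, ∫ y : ℝ, frozenKernel a x t y s * density a γ y s ξ τ

/-- The derivative `Γₓ(x,t;ξ,τ)`. -/
def GamX (a : ℝ × ℝ → ℝ) (γ x t ξ τ : ℝ) : ℝ :=
  deriv (fun x' => Gam a γ x' t ξ τ) x

/-- On `ℝ × [0,T]` every series and integral in the construction of `Γ` converges absolutely,
and `Γ` is differentiable in `x`. -/
structure WellDefined (a : ℝ × ℝ → ℝ) (γ T : ℝ) : Prop where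
  iterated : ∀ x t ξ τ : ℝ, 0 ≤ τ → τ < t → t ≤ T → ∀ n : ℕ,
    IntegrableOn (fun q : ℝ × ℝ =>
      parametrixError a γ x t q.1 q.2 * iteratedError a γ n q.1 q.2 ξ τ) (univ ×ˢ Ioo τ t)
  series : ∀ x t ξ τ : ℝ, 0 ≤ τ → τ < t → t ≤ T →
    Summable (fun n : ℕ => |iteratedError a γ n x t ξ τ|)
  correction : ∀ x t ξ τ : ℝ, 0 ≤ τ → τ < t → t ≤ T →
    IntegrableOn (fun q : ℝ × ℝ =>
      frozenKernel a x t q.1 q.2 * density a γ q.1 q.2 ξ τ) (univ ×ˢ Ioo τ t)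
  differentiable : ∀ x t ξ τ : ℝ, 0 ≤ τ → τ < t → t ≤ T →
    DifferentiableAt ℝ (fun x' => Gam a γ x' t ξ τ) x

/-- The Duhamel integral `M_f`. -/
def duhamel (a : ℝ × ℝ → ℝ) (γ : ℝ) (f : ℝ × ℝ → ℝ) (p : ℝ × ℝ) : ℝ :=
  ∫ τ in (0 : ℝ)..p.2, ∫ ξ : ℝ, Gam a γ p.1 p.2 ξ τ * f (ξ, τ)

/-- The Duhamel integral `M_{f,x}` with kernel `Γₓ`. -/
def duhamelX (a : ℝ × ℝ → ℝ) (γ : ℝ) (f : ℝ × ℝ → ℝ) (p : ℝ × ℝ) : ℝ :=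
  ∫ τ in (0 : ℝ)..p.2, ∫ ξ : ℝ, GamX a γ p.1 p.2 ξ τ * f (ξ, τ)

/-- Lebesgue measure on `Ω_T = ℝ × (0,T]`. -/
def stripMeasure (T : ℝ) : Measure (ℝ × ℝ) :=
  (volume : Measure (ℝ × ℝ)).restrict (univ ×ˢ Ioc 0 T)

/-- The norm of `L^∞((0,T), L²(ℝ))`. -/
def normLinfL2 (T : ℝ) (f : ℝ × ℝ → ℝ) : ℝ≥0∞ :=
  essSup (fun t : ℝ => eLpNorm (fun x : ℝ => f (x, t)) 2 volume)
    ((volume : Measure ℝ).restrict (Ioo 0 T))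

end ParabolicKernel

end

namespace ParabolicKernel

/-! Everything is measured against one Gaussian, the heat kernel `G` with coefficient `2M`.
Enlarging the coefficient absorbs polynomial factors in `(x-ξ)²/(t-τ)`, so the parametrix `H` is
bounded by a multiple of `G` and its `x`-derivative by a multiple of `(t-τ)^(-1/2) G`. Since `H`
solves the equation with frozen coefficient, its error is `(a(x,t) - a(ξ,τ)) H_xx - γ H`. Hölder
continuity of exponent `1/2` gains `(t-τ)^(1/4)` on the singularity `(t-τ)^(-1)` of `H_xx`, leaving
`(t-τ)^(-3/4) G`, which is integrable.

By the semigroup property, composing `u(t-τ) G` with `v(t-τ) G` gives exactly `(u∗v)(t-τ) G`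
(`lintegral_profileKernel_mul`), so the parametrix series reduces to convolutions in time. In the
weight `t^(-3/4) e^(l t)` with `l` large, convolution with the profile of the error contracts by
`1/2` (`exists_timeConv_exp_le`), and the Neumann series is dominated by a geometric one. Hence `|Φ|
≤ C t^(-3/4) G`, `|Γ| ≤ C G` and `|Γₓ| ≤ C t^(-1/2) G` with `t` the elapsed time
(`exists_kernelBounds`).

The four estimates need only the last two bounds. The space-time `L²` norm of `G` up to time `T` is
of order `T^(1/4)`; the spatial `L²` norm of `G` is of order `t^(-1/4)`, and `t^(-1/2) t^(-1/4)`
integrates to order `T^(1/4)`; Schur's test, with kernel masses of order `T` and `√T`, gives the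
`L²` bounds. -/

/-! ### Heat kernel: semigroup property, derivatives, Gaussian domination -/

lemma heatKernel_nonneg (c x t : ℝ) : 0 ≤ heatKernel c x t := by
  unfold heatKernel; positivity

/-- The junk value is useful: `Real.sqrt` of a nonpositive number is `0`, and so is its inverse.
Kernels built from `heatKernel` are therefore causal without any indicator. -/
lemma heatKernel_of_nonpos {c t : ℝ} (hc : 0 ≤ c) (ht : t ≤ 0) (x : ℝ) : heatKernel c x t = 0 := by
  have : 4 * Real.pi * c * t ≤ 0 := mul_nonpos_of_nonneg_of_nonpos (by positivity) ht
  simp [heatKernel, Real.sqrt_eq_zero_of_nonpos this]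

lemma heatKernel_eq_gaussianPDFReal {c t : ℝ} (hc : 0 < c) (ht : 0 < t) (x y : ℝ) :
    heatKernel c (x - y) t = ProbabilityTheory.gaussianPDFReal y (2 * c * t).toNNReal x := by
  rw [heatKernel, ProbabilityTheory.gaussianPDFReal, Real.coe_toNNReal _ (by positivity)]
  ring_nf

lemma heatKernel_neg (c x t : ℝ) : heatKernel c (-x) t = heatKernel c x t := by
  simp [heatKernel]

lemma heatKernel_sub_comm (c x y t : ℝ) : heatKernel c (x - y) t = heatKernel c (y - x) t := by
  rw [← heatKernel_neg, neg_sub]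

lemma heatKernel_le {c t : ℝ} (hc : 0 < c) (ht : 0 < t) (x : ℝ) :
    heatKernel c x t ≤ (Real.sqrt (4 * Real.pi * c))⁻¹ * t ^ (-(1 / 2) : ℝ) := by
  have h1 : (Real.sqrt (4 * Real.pi * c * t))⁻¹
      = (Real.sqrt (4 * Real.pi * c))⁻¹ * t ^ (-(1 / 2) : ℝ) := by
    rw [Real.sqrt_mul (by positivity), mul_inv, Real.rpow_neg ht.le, Real.sqrt_eq_rpow t]
  rw [heatKernel, ← h1]
  refine mul_le_of_le_one_right (by positivity) (Real.exp_le_one_iff.2 ?_)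
  rw [neg_div]
  exact neg_nonpos.2 (by positivity)

lemma measurable_heatKernel_uncurry :
    Measurable (fun z : ℝ × ℝ × ℝ => heatKernel z.1 z.2.1 z.2.2) := by
  unfold heatKernel; fun_prop

lemma measurable_heatKernel {α : Type*} [MeasurableSpace α] {b x t : α → ℝ} (hb : Measurable b)
    (hx : Measurable x) (ht : Measurable t) :
    Measurable (fun z => heatKernel (b z) (x z) (t z)) :=
  measurable_heatKernel_uncurry.comp (hb.prodMk (hx.prodMk ht))

lemma lintegral_heatKernel_sub {c t : ℝ} (hc : 0 < c) (ht : 0 < t) (y : ℝ) :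
    ∫⁻ x, ENNReal.ofReal (heatKernel c (x - y) t) = 1 := by
  simp_rw [heatKernel_eq_gaussianPDFReal hc ht]
  apply ProbabilityTheory.lintegral_gaussianPDFReal_eq_one
  exact (Real.toNNReal_pos.2 (by positivity)).ne'

/-- Completing the square in `y`: the product is a Gaussian in `y` around the weighted mean of `x`
and `z`, times a factor free of `y`. -/
lemma heatKernel_mul_heatKernel {c s t : ℝ} (hc : 0 < c) (hs : 0 < s) (ht : 0 < t) (x y z : ℝ) :
    heatKernel c (x - y) s * heatKernel c (y - z) t = heatKernel c (x - z) (s + t) *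
      heatKernel c (y - (t * x + s * z) / (s + t)) (s * t / (s + t)) := by
  have hst : 0 < s + t := by positivity
  unfold heatKernel
  have h1 : (Real.sqrt (4 * Real.pi * c * s))⁻¹ * (Real.sqrt (4 * Real.pi * c * t))⁻¹ =
      (Real.sqrt (4 * Real.pi * c * (s + t)))⁻¹ *
        (Real.sqrt (4 * Real.pi * c * (s * t / (s + t))))⁻¹ := by
    rw [← mul_inv, ← mul_inv, ← Real.sqrt_mul (by positivity), ← Real.sqrt_mul (by positivity)]
    congr 2
    field_simp
  have h2 : Real.exp (-(x - y) ^ 2 / (4 * c * s)) * Real.exp (-(y - z) ^ 2 / (4 * c * t)) =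
      Real.exp (-(x - z) ^ 2 / (4 * c * (s + t))) *
        Real.exp (-(y - (t * x + s * z) / (s + t)) ^ 2 / (4 * c * (s * t / (s + t)))) := by
    rw [← Real.exp_add, ← Real.exp_add]
    congr 1
    field_simp
    ring
  calc _ = ((Real.sqrt (4 * Real.pi * c * s))⁻¹ * (Real.sqrt (4 * Real.pi * c * t))⁻¹) *
      (Real.exp (-(x - y) ^ 2 / (4 * c * s)) * Real.exp (-(y - z) ^ 2 / (4 * c * t))) := by ring
    _ = _ := by rw [h1, h2]; ring

/-- The semigroup property of the heat kernel. -/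
lemma lintegral_heatKernel_mul_heatKernel {c s t : ℝ} (hc : 0 < c) (hs : 0 < s) (ht : 0 < t)
    (x z : ℝ) :
    ∫⁻ y, ENNReal.ofReal (heatKernel c (x - y) s) * ENNReal.ofReal (heatKernel c (y - z) t) =
      ENNReal.ofReal (heatKernel c (x - z) (s + t)) := by
  simp_rw [← ENNReal.ofReal_mul (heatKernel_nonneg _ _ _), heatKernel_mul_heatKernel hc hs ht,
    ENNReal.ofReal_mul (heatKernel_nonneg _ _ _)]
  rw [lintegral_const_mul _ (measurable_heatKernel (by fun_prop) (by fun_prop)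
    (by fun_prop)).ennreal_ofReal, lintegral_heatKernel_sub hc (by positivity), mul_one]

lemma hasDerivAt_heatKernel {b t : ℝ} (x : ℝ) :
    HasDerivAt (fun x => heatKernel b x t) (-(x / (2 * b * t)) * heatKernel b x t) x := by
  have h : HasDerivAt (fun x : ℝ => -x ^ 2 / (4 * b * t)) (-(x / (2 * b * t))) x := by
    refine ((hasDerivAt_pow 2 x).fun_neg.div_const (4 * b * t)).congr_deriv ?_
    norm_num
    rw [← mul_div_mul_left x (2 * b * t) two_ne_zero]
    ring
  unfold heatKernel
  refine (h.exp.const_mul ((Real.sqrt (4 * Real.pi * b * t))⁻¹)).congr_deriv ?_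
  ring

lemma hasDerivAt_deriv_heatKernel {b t : ℝ} (x : ℝ) :
    HasDerivAt (fun x => -(x / (2 * b * t)) * heatKernel b x t)
      ((x ^ 2 / (2 * b * t) ^ 2 - 1 / (2 * b * t)) * heatKernel b x t) x := by
  refine (((hasDerivAt_id x).div_const (2 * b * t)).fun_neg.fun_mul
    (hasDerivAt_heatKernel x)).congr_deriv ?_
  simp only [id]
  ring

lemma hasDerivAt_heatKernel_time {b t : ℝ} (hb : 0 < b) (ht : 0 < t) (x : ℝ) :
    HasDerivAt (fun t => heatKernel b x t)
      (b * ((x ^ 2 / (2 * b * t) ^ 2 - 1 / (2 * b * t)) * heatKernel b x t)) t := by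
  have hpos : 0 < 4 * Real.pi * b * t := by positivity
  have h1 : HasDerivAt (fun t : ℝ => 4 * Real.pi * b * t) (4 * Real.pi * b) t := by
    simpa using (hasDerivAt_id t).const_mul (4 * Real.pi * b)
  have h2 := (h1.sqrt hpos.ne').fun_inv (Real.sqrt_pos.2 hpos).ne'
  have h3 : HasDerivAt (fun t : ℝ => -x ^ 2 / (4 * b * t)) (x ^ 2 / (4 * b * t ^ 2)) t := by
    have h4 : HasDerivAt (fun t : ℝ => 4 * b * t) (4 * b) t := by
      simpa using (hasDerivAt_id t).const_mul (4 * b)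
    refine ((hasDerivAt_const t (-x ^ 2)).fun_div h4 (by positivity)).congr_deriv ?_
    field_simp
    ring
  unfold heatKernel
  refine (h2.fun_mul h3.exp).congr_deriv ?_
  have hsq : Real.sqrt (4 * Real.pi * b * t) ^ 2 = 4 * Real.pi * b * t := Real.sq_sqrt hpos.le
  have hs := (Real.sqrt_pos.2 hpos).ne'
  rw [hsq]
  field_simp
  ring

/-- The frozen kernel satisfies `∂ₜH = a(ξ,τ) ∂ₓₓH`, so only the difference of the coefficients
survives in front of `∂ₓₓH`. -/
lemma parametrixError_eq {a : ℝ × ℝ → ℝ} {γ x t ξ τ : ℝ} (ha : 0 < a (ξ, τ)) (h : τ < t) :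
    parametrixError a γ x t ξ τ =
      (a (x, t) - a (ξ, τ)) * ((x - ξ) ^ 2 / (2 * a (ξ, τ) * (t - τ)) ^ 2
        - 1 / (2 * a (ξ, τ) * (t - τ))) * heatKernel (a (ξ, τ)) (x - ξ) (t - τ)
        - γ * heatKernel (a (ξ, τ)) (x - ξ) (t - τ) := by
  have ht : 0 < t - τ := sub_pos.2 h
  have h1 : deriv (fun t' => frozenKernel a x t' ξ τ) t = _ :=
    ((hasDerivAt_heatKernel_time ha ht (x - ξ)).comp_sub_const t τ).deriv
  have h2 : deriv (fun x' => frozenKernel a x' t ξ τ) = fun x' =>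
      -((x' - ξ) / (2 * a (ξ, τ) * (t - τ))) * heatKernel (a (ξ, τ)) (x' - ξ) (t - τ) := by
    ext x'
    exact ((hasDerivAt_heatKernel (x' - ξ)).comp_sub_const x' ξ).deriv
  have h3 : iteratedDeriv 2 (fun x' => frozenKernel a x' t ξ τ) x =
      ((x - ξ) ^ 2 / (2 * a (ξ, τ) * (t - τ)) ^ 2 - 1 / (2 * a (ξ, τ) * (t - τ))) *
        heatKernel (a (ξ, τ)) (x - ξ) (t - τ) := by
    rw [iteratedDeriv_succ, iteratedDeriv_one, h2]
    exact ((hasDerivAt_deriv_heatKernel (x - ξ)).comp_sub_const x ξ).deriv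
  rw [parametrixError, parabolicOp, h1, h3]
  simp only [frozenKernel]
  ring

/-- Polynomial factors are absorbed by enlarging the diffusion coefficient. -/
lemma exists_mul_heatKernel_le {m M : ℝ} (hm : 0 < m) (hmM : m ≤ M) :
    ∃ C : ℝ, 0 < C ∧ ∀ b x t : ℝ, m ≤ b → b ≤ M → 0 < t →
      (1 + x ^ 2 / t) ^ 2 * heatKernel b x t ≤ C * heatKernel (2 * M) x t := by
  have hM : 0 < M := hm.trans_le hmM
  refine ⟨(2 + 256 * M ^ 2) * Real.sqrt (2 * M / m), by positivity, fun b x t hb hbM ht => ?_⟩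
  have hb0 : 0 < b := hm.trans_le hb
  set r := x ^ 2 / t with hr
  have hr0 : 0 ≤ r := by positivity
  -- The decay `exp(-r/(4M))` is split into two equal halves: one pays for the polynomial, the other
  -- is the exponential of the kernel with coefficient `2M`.
  have h1 : (1 + r) ^ 2 ≤ (2 + 256 * M ^ 2) * Real.exp (r / (8 * M)) := by
    have h := Real.quadratic_le_exp_of_nonneg (x := r / (8 * M)) (by positivity)
    have h2 : r ^ 2 = 128 * M ^ 2 * ((r / (8 * M)) ^ 2 / 2) := by field_simp; ring
    have h3 : (0:ℝ) ≤ r / (8 * M) := by positivity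
    have h4 : (r / (8 * M)) ^ 2 / 2 ≤ Real.exp (r / (8 * M)) := by nlinarith
    have h5 : 1 ≤ Real.exp (r / (8 * M)) := Real.one_le_exp h3
    have h6 : r ^ 2 ≤ 128 * M ^ 2 * Real.exp (r / (8 * M)) := by rw [h2]; gcongr
    nlinarith [sq_nonneg (1 - r)]
  have h2 : Real.exp (-x ^ 2 / (4 * b * t)) ≤ Real.exp (-(r / (4 * M))) := by
    apply Real.exp_le_exp.2
    have : -x ^ 2 / (4 * b * t) = -(r / (4 * b)) := by rw [hr]; field_simp
    rw [this]
    gcongr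
  have h3 : (Real.sqrt (4 * Real.pi * b * t))⁻¹ ≤
      Real.sqrt (2 * M / m) * (Real.sqrt (4 * Real.pi * (2 * M) * t))⁻¹ := by
    have : Real.sqrt (2 * M / m) * (Real.sqrt (4 * Real.pi * (2 * M) * t))⁻¹ =
        (Real.sqrt (4 * Real.pi * m * t))⁻¹ := by
      rw [← Real.sqrt_inv, ← Real.sqrt_inv, ← Real.sqrt_mul (by positivity)]
      congr 1
      field_simp
    rw [this]
    gcongr
  calc (1 + r) ^ 2 * heatKernel b x t
      ≤ ((2 + 256 * M ^ 2) * Real.exp (r / (8 * M))) *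
        ((Real.sqrt (2 * M / m) * (Real.sqrt (4 * Real.pi * (2 * M) * t))⁻¹) *
          Real.exp (-(r / (4 * M)))) := by
        unfold heatKernel; gcongr
    _ = (2 + 256 * M ^ 2) * Real.sqrt (2 * M / m) * ((Real.sqrt (4 * Real.pi * (2 * M) * t))⁻¹ *
          (Real.exp (r / (8 * M)) * Real.exp (-(r / (4 * M))))) := by ring
    _ = _ := by
        rw [← Real.exp_add, heatKernel]
        congr 3
        rw [hr]; field_simp; ring

/-! ### Space-time kernels with a profile in time -/

/-- The space-time kernel `u(t - τ) G(x - ξ, t - τ)`, with `G` the heat kernel with coefficient `c`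
and `u` a profile in time. -/
noncomputable def profileKernel (c : ℝ) (u : ℝ → ℝ≥0∞) (p q : ℝ × ℝ) : ℝ≥0∞ :=
  u (p.2 - q.2) * ENNReal.ofReal (heatKernel c (p.1 - q.1) (p.2 - q.2))

/-- Convolution in time on `(0, t)`. -/
noncomputable def timeConv (u v : ℝ → ℝ≥0∞) (t : ℝ) : ℝ≥0∞ :=
  ∫⁻ s in Ioo 0 t, u (t - s) * v s

lemma profileKernel_of_le {c : ℝ} (hc : 0 ≤ c) (u : ℝ → ℝ≥0∞) {p q : ℝ × ℝ} (h : p.2 ≤ q.2) :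
    profileKernel c u p q = 0 := by
  simp [profileKernel, heatKernel_of_nonpos hc (sub_nonpos.2 h)]

lemma profileKernel_mono {c : ℝ} {u v : ℝ → ℝ≥0∞} {p q : ℝ × ℝ}
    (h : u (p.2 - q.2) ≤ v (p.2 - q.2)) : profileKernel c u p q ≤ profileKernel c v p q :=
  mul_le_mul_left h _

lemma profileKernel_ne_top {c : ℝ} {u : ℝ → ℝ≥0∞} {p q : ℝ × ℝ} (h : u (p.2 - q.2) ≠ ∞) :
    profileKernel c u p q ≠ ∞ :=
  ENNReal.mul_ne_top h ENNReal.ofReal_ne_top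

lemma measurable_profileKernel (c : ℝ) {u : ℝ → ℝ≥0∞} (hu : Measurable u) :
    Measurable (fun z : (ℝ × ℝ) × (ℝ × ℝ) => profileKernel c u z.1 z.2) := by
  unfold profileKernel
  exact (hu.comp (by fun_prop)).mul (measurable_heatKernel (by fun_prop) (by fun_prop)
    (by fun_prop)).ennreal_ofReal

lemma measurable_profileKernel_left (c : ℝ) {u : ℝ → ℝ≥0∞} (hu : Measurable u) (q : ℝ × ℝ) :
    Measurable (fun p => profileKernel c u p q) :=
  (measurable_profileKernel c hu).comp (measurable_id.prodMk measurable_const)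

lemma measurable_profileKernel_right (c : ℝ) {u : ℝ → ℝ≥0∞} (hu : Measurable u) (p : ℝ × ℝ) :
    Measurable (fun q => profileKernel c u p q) :=
  (measurable_profileKernel c hu).comp (measurable_const.prodMk measurable_id)

/-- By the semigroup property the Gaussian left after integrating in `y` does not depend on the
intermediate time `s`; it factors out of the time integral. -/
lemma lintegral_slice_profileKernel_mul {c : ℝ} (hc : 0 < c) (u v : ℝ → ℝ≥0∞) (p q : ℝ × ℝ)
    (s : ℝ) :
    ∫⁻ y, profileKernel c u p (y, s) * profileKernel c v (y, s) q =
      (Ioo q.2 p.2).indicator (fun s => u (p.2 - s) * v (s - q.2)) s *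
        ENNReal.ofReal (heatKernel c (p.1 - q.1) (p.2 - q.2)) := by
  by_cases hs : s ∈ Ioo q.2 p.2
  · have h : ∀ y, profileKernel c u p (y, s) * profileKernel c v (y, s) q =
        (u (p.2 - s) * v (s - q.2)) * (ENNReal.ofReal (heatKernel c (p.1 - y) (p.2 - s)) *
          ENNReal.ofReal (heatKernel c (y - q.1) (s - q.2))) := fun y => by
      simp only [profileKernel]; ring
    simp_rw [h]
    rw [lintegral_const_mul, lintegral_heatKernel_mul_heatKernel hc (sub_pos.2 hs.2)
      (sub_pos.2 hs.1), indicator_of_mem hs, sub_add_sub_cancel]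
    exact (measurable_heatKernel (by fun_prop) (by fun_prop) (by fun_prop)).ennreal_ofReal.mul
      (measurable_heatKernel (by fun_prop) (by fun_prop) (by fun_prop)).ennreal_ofReal
  · rw [indicator_of_notMem hs, zero_mul]
    refine (lintegral_congr fun y => ?_).trans lintegral_zero
    by_cases h1 : q.2 < s
    · rw [profileKernel_of_le hc.le u (not_lt.1 fun h2 => hs ⟨h1, h2⟩), zero_mul]
    · rw [profileKernel_of_le hc.le v (not_lt.1 h1), mul_zero]

lemma timeConv_eq_lintegral_Ioo (u v : ℝ → ℝ≥0∞) (τ t : ℝ) :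
    ∫⁻ s in Ioo τ t, u (t - s) * v (s - τ) = timeConv u v (t - τ) := by
  rw [timeConv, ← lintegral_indicator measurableSet_Ioo, ← lintegral_indicator measurableSet_Ioo,
    ← lintegral_sub_right_eq_self ((Ioo 0 (t - τ)).indicator _) τ]
  refine lintegral_congr fun s => ?_
  by_cases hs : s ∈ Ioo τ t
  · rw [indicator_of_mem hs, indicator_of_mem (by simpa using hs)]
    simp
  · rw [indicator_of_notMem hs, indicator_of_notMem (by simpa using hs)]

/-- An equality with the same coefficient `c` throughout, so iteration does not degrade the Gaussian
and only the profiles have to be estimated. -/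
lemma lintegral_profileKernel_mul {c : ℝ} (hc : 0 < c) {u v : ℝ → ℝ≥0∞} (hu : Measurable u)
    (hv : Measurable v) (p q : ℝ × ℝ) :
    ∫⁻ r, profileKernel c u p r * profileKernel c v r q =
      profileKernel c (timeConv u v) p q := by
  have hmeas : Measurable (fun r => profileKernel c u p r * profileKernel c v r q) :=
    (measurable_profileKernel_right c hu p).mul (measurable_profileKernel_left c hv q)
  rw [Measure.volume_eq_prod, lintegral_prod_symm _ hmeas.aemeasurable]
  simp_rw [lintegral_slice_profileKernel_mul hc]
  rw [lintegral_mul_const _ (Measurable.indicator (by fun_prop) measurableSet_Ioo),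
    lintegral_indicator measurableSet_Ioo, timeConv_eq_lintegral_Ioo, profileKernel]

/-! ### Convolution of singular profiles in time -/

lemma lintegral_Ioo_sub_left {F : ℝ → ℝ≥0∞} (t : ℝ) :
    ∫⁻ s in Ioo 0 t, F (t - s) = ∫⁻ s in Ioo 0 t, F s := by
  rw [← lintegral_indicator measurableSet_Ioo, ← lintegral_indicator measurableSet_Ioo,
    ← lintegral_sub_left_eq_self _ t]
  refine lintegral_congr fun s => ?_
  by_cases hs : s ∈ Ioo 0 t
  · rw [indicator_of_mem hs, indicator_of_mem (by simpa using hs.symm)]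
    simp
  · rw [indicator_of_notMem hs, indicator_of_notMem]
    simpa [and_comm] using hs

lemma lintegral_rpow_Ioo {β t : ℝ} (hβ : β < 1) (ht : 0 ≤ t) :
    ∫⁻ s in Ioo 0 t, ENNReal.ofReal (s ^ (-β)) = ENNReal.ofReal (t ^ (1 - β) / (1 - β)) := by
  have hint : IntervalIntegrable (fun s : ℝ => s ^ (-β)) volume 0 t :=
    intervalIntegral.intervalIntegrable_rpow' (by linarith)
  rw [intervalIntegrable_iff_integrableOn_Ioo_of_le ht] at hint
  rw [← ofReal_integral_eq_lintegral_ofReal hint, ← integral_Ioc_eq_integral_Ioo,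
    ← intervalIntegral.integral_of_le ht, integral_rpow (Or.inl (by linarith))]
  · rw [Real.zero_rpow (by linarith), sub_zero, neg_add_eq_sub]
  · filter_upwards [ae_restrict_mem measurableSet_Ioo] with s hs
    exact Real.rpow_nonneg hs.1.le _

/-- The Beta integral estimate `∫₀ᵗ (t-s)^(-α) s^(-β) ds ≤ C t^(1-α-β)`. -/
lemma exists_timeConv_rpow_le {α β : ℝ} (hα : 0 ≤ α) (hβ : 0 ≤ β) (hα1 : α < 1) (hβ1 : β < 1) :
    ∃ C : ℝ, 0 < C ∧ ∀ t, 0 < t → timeConv (fun s => ENNReal.ofReal (s ^ (-α)))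
      (fun s => ENNReal.ofReal (s ^ (-β))) t ≤ ENNReal.ofReal (C * t ^ (1 - α - β)) := by
  refine ⟨2 ^ α / (1 - β) + 2 ^ β / (1 - α), ?_, fun t ht => ?_⟩
  · have := sub_pos.2 hα1
    have := sub_pos.2 hβ1
    positivity
  -- On each side of `t/2` only one factor is singular; the other is at most its value at `t/2`.
  have hpt : ∀ s ∈ Ioo 0 t, ENNReal.ofReal ((t - s) ^ (-α)) * ENNReal.ofReal (s ^ (-β)) ≤
      ENNReal.ofReal ((t / 2) ^ (-α)) * ENNReal.ofReal (s ^ (-β)) +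
      ENNReal.ofReal ((t / 2) ^ (-β)) * ENNReal.ofReal ((t - s) ^ (-α)) := by
    intro s hs
    have h0 : 0 < t - s := sub_pos.2 hs.2
    rcases le_total s (t / 2) with h | h
    · refine le_add_right (mul_le_mul_left (ENNReal.ofReal_le_ofReal ?_) _)
      exact Real.rpow_le_rpow_of_nonpos (by positivity) (by linarith) (by linarith)
    · refine le_add_left ?_
      rw [mul_comm]
      refine mul_le_mul_left (ENNReal.ofReal_le_ofReal ?_) _
      exact Real.rpow_le_rpow_of_nonpos (by positivity) (by linarith) (by linarith)
  refine (setLIntegral_mono' measurableSet_Ioo hpt).trans (le_of_eq ?_)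
  rw [lintegral_add_left (by fun_prop), lintegral_const_mul _ (by fun_prop),
    lintegral_const_mul _ (by fun_prop),
    lintegral_Ioo_sub_left (F := fun s => ENNReal.ofReal (s ^ (-α))),
    lintegral_rpow_Ioo hβ1 ht.le, lintegral_rpow_Ioo hα1 ht.le,
    ← ENNReal.ofReal_mul (by positivity), ← ENNReal.ofReal_mul (by positivity),
    ← ENNReal.ofReal_add]
  · congr 1
    have e1 : (t / 2) ^ (-α) * t ^ (1 - β) = 2 ^ α * t ^ (1 - α - β) := by
      rw [div_eq_mul_inv, Real.mul_rpow ht.le (by norm_num), Real.inv_rpow (by norm_num),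
        Real.rpow_neg (by norm_num : (0:ℝ) ≤ 2), inv_inv, mul_comm, ← mul_assoc,
        ← Real.rpow_add ht, mul_comm]
      ring_nf
    have e2 : (t / 2) ^ (-β) * t ^ (1 - α) = 2 ^ β * t ^ (1 - α - β) := by
      rw [div_eq_mul_inv, Real.mul_rpow ht.le (by norm_num), Real.inv_rpow (by norm_num),
        Real.rpow_neg (by norm_num : (0:ℝ) ≤ 2), inv_inv, mul_comm, ← mul_assoc,
        ← Real.rpow_add ht, mul_comm]
      ring_nf
    rw [← mul_div_assoc, ← mul_div_assoc, e1, e2]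
    ring
  · have := sub_pos.2 hβ1
    positivity
  · have := sub_pos.2 hα1
    positivity

/-- Convolution with an integrable power is a contraction for exponentially weighted profiles,
as soon as the weight is strong enough. -/
lemma exists_timeConv_exp_le {β ε : ℝ} (hβ : 0 ≤ β) (hβ1 : β < 1) (hε : 0 < ε) :
    ∃ l : ℝ, 0 < l ∧ ∀ t, 0 < t → timeConv (fun s => ENNReal.ofReal (s ^ (-β)))
      (fun s => ENNReal.ofReal (s ^ (-β) * Real.exp (l * s))) t ≤
        ENNReal.ofReal ε * ENNReal.ofReal (t ^ (-β) * Real.exp (l * t)) := by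
  have hβ' := sub_pos.2 hβ1
  have hG : 0 < Real.Gamma (1 - β) := Real.Gamma_pos_of_pos hβ'
  -- The weight `l` is tuned so that `∫₀^∞ s^(-β) e^(-l s) ds = δ Γ(1-β)`. In `δ`, the factor `2^β`
  -- pays for `(t/2)^(-β)` and the factor `2` for the two halves of `(0,t)`.
  set δ := ε / (2 * 2 ^ β * Real.Gamma (1 - β)) with hδ
  have hδ0 : 0 < δ := by positivity
  refine ⟨δ ^ (-(1 / (1 - β))), by positivity, fun t ht => ?_⟩
  set l := δ ^ (-(1 / (1 - β))) with hl
  have hl0 : 0 < l := by positivity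
  have hJ : ∫⁻ s in Ioo 0 t, ENNReal.ofReal (s ^ (-β) * Real.exp (-(l * s))) ≤
      ENNReal.ofReal (δ * Real.Gamma (1 - β)) := by
    refine (lintegral_mono_set Ioo_subset_Ioi_self).trans (le_of_eq ?_)
    have h1 := Real.integral_rpow_mul_exp_neg_mul_Ioi hβ' hl0
    have h2 : (1 / l) ^ (1 - β) = δ := by
      rw [hl, one_div, Real.rpow_neg hδ0.le, inv_inv, ← Real.rpow_mul hδ0.le]
      rw [one_div_mul_cancel hβ'.ne', Real.rpow_one]
    rw [h2, show 1 - β - 1 = -β by ring] at h1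
    rw [← h1, ofReal_integral_eq_lintegral_ofReal]
    -- A non-integrable function would have Bochner integral `0`, whereas the Gamma formula gives a
    -- positive value.
    · by_contra h
      rw [integral_undef h] at h1
      have : 0 < δ * Real.Gamma (1 - β) := by positivity
      linarith
    · filter_upwards [ae_restrict_mem measurableSet_Ioi] with s hs
      exact mul_nonneg (Real.rpow_nonneg (le_of_lt hs) _) (Real.exp_pos _).le
  set F : ℝ → ℝ≥0∞ := fun s => ENNReal.ofReal (s ^ (-β) * Real.exp (-(l * s))) with hF
  have hFm : Measurable F := by fun_prop
  -- After `e^(l t)` is taken out, `e^(-l (t-s))` remains. For `s ≤ t/2` it is replaced by the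
  -- larger `e^(-l s)`, so that the decay always accompanies the factor that is still singular.
  have hpt : ∀ s ∈ Ioo 0 t, ENNReal.ofReal ((t - s) ^ (-β)) *
      ENNReal.ofReal (s ^ (-β) * Real.exp (l * s)) ≤
      ENNReal.ofReal ((t / 2) ^ (-β) * Real.exp (l * t)) * (F (t - s) + F s) := by
    intro s hs
    have h0 : 0 < t - s := sub_pos.2 hs.2
    have h1 : 0 < s := hs.1
    have hexp : Real.exp (l * s) = Real.exp (l * t) * Real.exp (-(l * (t - s))) := by
      rw [← Real.exp_add]; ring_nf
    rw [mul_add, ← ENNReal.ofReal_mul (by positivity), ← ENNReal.ofReal_mul (by positivity),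
      ← ENNReal.ofReal_mul (by positivity), hexp]
    rcases le_total s (t / 2) with h | h
    · refine le_add_left (ENNReal.ofReal_le_ofReal ?_)
      have e1 : (t - s) ^ (-β) ≤ (t / 2) ^ (-β) :=
        Real.rpow_le_rpow_of_nonpos (by positivity) (by linarith) (by linarith)
      have e2 : Real.exp (-(l * (t - s))) ≤ Real.exp (-(l * s)) := by
        apply Real.exp_le_exp.2
        nlinarith
      calc (t - s) ^ (-β) * (s ^ (-β) * (Real.exp (l * t) * Real.exp (-(l * (t - s)))))
          ≤ (t / 2) ^ (-β) * (s ^ (-β) * (Real.exp (l * t) * Real.exp (-(l * s)))) := by gcongr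
        _ = _ := by ring
    · refine le_add_right (ENNReal.ofReal_le_ofReal ?_)
      have e1 : s ^ (-β) ≤ (t / 2) ^ (-β) :=
        Real.rpow_le_rpow_of_nonpos (by positivity) (by linarith) (by linarith)
      calc (t - s) ^ (-β) * (s ^ (-β) * (Real.exp (l * t) * Real.exp (-(l * (t - s)))))
          ≤ (t - s) ^ (-β) * ((t / 2) ^ (-β) *
            (Real.exp (l * t) * Real.exp (-(l * (t - s))))) := by gcongr
        _ = _ := by ring
  refine (setLIntegral_mono' measurableSet_Ioo hpt).trans ?_
  rw [lintegral_const_mul _ (by fun_prop), lintegral_add_left (by fun_prop),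
    lintegral_Ioo_sub_left]
  refine (mul_le_mul_right (add_le_add hJ hJ) _).trans (le_of_eq ?_)
  rw [← ENNReal.ofReal_add (by positivity) (by positivity), ← ENNReal.ofReal_mul (by positivity),
    ← ENNReal.ofReal_mul hε.le]
  congr 1
  rw [div_eq_mul_inv, Real.mul_rpow ht.le (by norm_num), Real.inv_rpow (by norm_num),
    Real.rpow_neg (by norm_num : (0:ℝ) ≤ 2), inv_inv, hδ]
  field_simp
  norm_num

/-! ### Schur's test and Cauchy–Schwarz bounds for profile kernels -/

lemma sq_lintegral_mul_le {α : Type*} [MeasurableSpace α] (μ : Measure α) {f g : α → ℝ≥0∞}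
    (hf : AEMeasurable f μ) (hg : AEMeasurable g μ) :
    (∫⁻ a, f a * g a ∂μ) ^ 2 ≤ (∫⁻ a, f a ^ 2 ∂μ) * ∫⁻ a, g a ^ 2 ∂μ := by
  have h := ENNReal.lintegral_mul_le_Lp_mul_Lq μ Real.HolderConjugate.two_two hf hg
  simp only [Pi.mul_apply, ENNReal.rpow_ofNat] at h
  refine (pow_le_pow_left' h 2).trans (le_of_eq ?_)
  rw [mul_pow, ← ENNReal.rpow_natCast, ← ENNReal.rpow_natCast, ← ENNReal.rpow_mul,
    ← ENNReal.rpow_mul]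
  norm_num

/-- Schur's test. -/
lemma lintegral_sq_lintegral_mul_le {α β : Type*} [MeasurableSpace α] [MeasurableSpace β]
    {μ : Measure α} {ν : Measure β} [SFinite μ] [SFinite ν] {N : α → β → ℝ≥0∞} {F : β → ℝ≥0∞}
    (hN : Measurable (Function.uncurry N)) (hF : Measurable F) {A : ℝ≥0∞}
    (h₁ : ∀ p, ∫⁻ q, N p q ∂ν ≤ A) (h₂ : ∀ q, ∫⁻ p, N p q ∂μ ≤ A) :
    ∫⁻ p, (∫⁻ q, N p q * F q ∂ν) ^ 2 ∂μ ≤ A ^ 2 * ∫⁻ q, F q ^ 2 ∂ν := by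
  have hpt : ∀ p, (∫⁻ q, N p q * F q ∂ν) ^ 2 ≤ A * ∫⁻ q, N p q * F q ^ 2 ∂ν := by
    intro p
    have hNp : Measurable (N p) := hN.comp measurable_prodMk_left
    -- Cauchy–Schwarz against the constant `1` for the measure `N p · ν`, whose total mass is at
    -- most `A`.
    have h := sq_lintegral_mul_le (ν.withDensity (N p)) (f := fun _ => 1) (g := F)
      (by fun_prop) hF.aemeasurable
    rw [lintegral_withDensity_eq_lintegral_mul _ hNp (by fun_prop),
      lintegral_withDensity_eq_lintegral_mul _ hNp (by fun_prop),
      lintegral_withDensity_eq_lintegral_mul _ hNp (by fun_prop)] at h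
    simp only [Pi.mul_apply, one_mul, one_pow, mul_one] at h
    exact h.trans (mul_le_mul_left (h₁ p) _)
  refine (lintegral_mono hpt).trans ?_
  have hm : Measurable (Function.uncurry fun p q => N p q * F q ^ 2) :=
    hN.mul ((hF.pow_const 2).comp measurable_snd)
  rw [lintegral_const_mul _ (Measurable.lintegral_prod_right hm),
    lintegral_lintegral_swap hm.aemeasurable, pow_two, mul_assoc]
  gcongr
  rw [← lintegral_const_mul _ (by fun_prop)]
  refine lintegral_mono fun q => ?_
  have hNq : Measurable fun p => N p q := hN.comp measurable_prodMk_right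
  rw [lintegral_mul_const _ hNq]
  exact mul_le_mul_left (h₂ q) _

/-- The heat kernel has mass one in either space variable, so only the mass of the profile remains.
This and its mirror image are the two hypotheses of Schur's test. -/
lemma lintegral_profileKernel_right {c : ℝ} (hc : 0 < c) {v : ℝ → ℝ≥0∞} (hv : Measurable v)
    (p : ℝ × ℝ) : ∫⁻ q, profileKernel c v p q = ∫⁻ s in Ioi 0, v s := by
  rw [Measure.volume_eq_prod,
    lintegral_prod_symm _ (measurable_profileKernel_right c hv p).aemeasurable,
    ← lintegral_indicator measurableSet_Ioi,
    ← lintegral_sub_left_eq_self ((Ioi (0 : ℝ)).indicator _) p.2]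
  refine lintegral_congr fun s => ?_
  by_cases hs : 0 < p.2 - s
  · rw [indicator_of_mem (mem_Ioi.2 hs)]
    simp only [profileKernel]
    simp_rw [heatKernel_sub_comm c p.1]
    rw [lintegral_const_mul _ (measurable_heatKernel (by fun_prop) (by fun_prop)
      (by fun_prop)).ennreal_ofReal, lintegral_heatKernel_sub hc hs, mul_one]
  · rw [indicator_of_notMem (by simpa using hs)]
    refine (lintegral_congr fun y => ?_).trans lintegral_zero
    exact profileKernel_of_le hc.le v (sub_nonpos.1 (not_lt.1 hs))

lemma lintegral_profileKernel_left {c : ℝ} (hc : 0 < c) {v : ℝ → ℝ≥0∞} (hv : Measurable v)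
    (q : ℝ × ℝ) : ∫⁻ p, profileKernel c v p q = ∫⁻ s in Ioi 0, v s := by
  rw [Measure.volume_eq_prod,
    lintegral_prod_symm _ (measurable_profileKernel_left c hv q).aemeasurable,
    ← lintegral_indicator measurableSet_Ioi,
    ← lintegral_sub_right_eq_self ((Ioi (0 : ℝ)).indicator _) q.2]
  refine lintegral_congr fun s => ?_
  by_cases hs : 0 < s - q.2
  · rw [indicator_of_mem (mem_Ioi.2 hs)]
    simp only [profileKernel]
    rw [lintegral_const_mul _ (measurable_heatKernel (by fun_prop) (by fun_prop)
      (by fun_prop)).ennreal_ofReal, lintegral_heatKernel_sub hc hs, mul_one]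
  · rw [indicator_of_notMem (by simpa using hs)]
    refine (lintegral_congr fun y => ?_).trans lintegral_zero
    exact profileKernel_of_le hc.le v (sub_nonpos.1 (not_lt.1 hs))

/-- One factor is bounded by its supremum, the other has mass one. -/
lemma lintegral_sq_heatKernel_le {c t : ℝ} (hc : 0 < c) (ht : 0 < t) (x : ℝ) :
    ∫⁻ y, ENNReal.ofReal (heatKernel c (x - y) t) ^ 2 ≤
      ENNReal.ofReal ((Real.sqrt (4 * Real.pi * c))⁻¹ * t ^ (-(1 / 2) : ℝ)) := by
  have hm : Measurable fun y => ENNReal.ofReal (heatKernel c (y - x) t) :=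
    (measurable_heatKernel (by fun_prop) (by fun_prop) (by fun_prop)).ennreal_ofReal
  calc _ ≤ ∫⁻ y, ENNReal.ofReal ((Real.sqrt (4 * Real.pi * c))⁻¹ * t ^ (-(1 / 2) : ℝ)) *
        ENNReal.ofReal (heatKernel c (y - x) t) := by
        refine lintegral_mono fun y => ?_
        rw [pow_two, heatKernel_sub_comm]
        exact mul_le_mul_left (ENNReal.ofReal_le_ofReal (heatKernel_le hc ht _)) _
    _ = _ := by rw [lintegral_const_mul _ hm, lintegral_heatKernel_sub hc ht, mul_one]

lemma sq_lintegral_profileKernel_mul_le {c : ℝ} (hc : 0 < c) {v : ℝ → ℝ≥0∞} (hv : Measurable v)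
    {F : ℝ × ℝ → ℝ≥0∞} (hF : Measurable F) (p : ℝ × ℝ) :
    (∫⁻ q, profileKernel c v p q * F q) ^ 2 ≤
      (∫⁻ s in Ioi 0, v s ^ 2 *
        ENNReal.ofReal ((Real.sqrt (4 * Real.pi * c))⁻¹ * s ^ (-(1 / 2) : ℝ))) *
        ∫⁻ q, F q ^ 2 := by
  have hm := measurable_profileKernel_right c hv p
  refine (sq_lintegral_mul_le _ hm.aemeasurable hF.aemeasurable).trans ?_
  gcongr
  rw [Measure.volume_eq_prod, lintegral_prod_symm _ (hm.pow_const 2).aemeasurable,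
    ← lintegral_indicator measurableSet_Ioi,
    ← lintegral_sub_left_eq_self ((Ioi (0 : ℝ)).indicator _) p.2]
  refine lintegral_mono fun s => ?_
  by_cases hs : 0 < p.2 - s
  · rw [indicator_of_mem (mem_Ioi.2 hs)]
    simp only [profileKernel, mul_pow]
    rw [lintegral_const_mul _ ((measurable_heatKernel (by fun_prop) (by fun_prop)
      (by fun_prop)).ennreal_ofReal.pow_const 2)]
    exact mul_le_mul_right (lintegral_sq_heatKernel_le hc hs _) _
  · rw [indicator_of_notMem (by simpa using hs)]
    refine (le_of_eq ((lintegral_congr fun y => ?_).trans lintegral_zero))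
    rw [profileKernel_of_le hc.le v (sub_nonpos.1 (not_lt.1 hs))]
    simp

/-- Cauchy–Schwarz is applied in space only. For the profile `t^(-1/2)` of `Γₓ`, Cauchy–Schwarz in
space-time would require `t^(-1) t^(-1/2)` to be integrable near `0`; slicewise only `t^(-1/2)
t^(-1/4)` appears. -/
lemma lintegral_profileKernel_mul_le_of_slice {c : ℝ} (hc : 0 < c) {v : ℝ → ℝ≥0∞}
    (hv : Measurable v) {F : ℝ × ℝ → ℝ≥0∞} (hF : Measurable F) {N : ℝ≥0∞}
    (hN : ∀ᵐ s : ℝ, (∫⁻ y, F (y, s) ^ 2) ≤ N ^ 2) (p : ℝ × ℝ) :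
    ∫⁻ q, profileKernel c v p q * F q ≤
      (∫⁻ s in Ioi 0, v s * ENNReal.ofReal ((4 * Real.pi * c) ^ (-(1 / 4) : ℝ) *
        s ^ (-(1 / 4) : ℝ))) * N := by
  have hm := measurable_profileKernel_right c hv p
  rw [Measure.volume_eq_prod,
    lintegral_prod_symm (fun q => profileKernel c v p q * F q) (hm.mul hF).aemeasurable,
    ← lintegral_mul_const _ (by fun_prop),
    ← lintegral_indicator measurableSet_Ioi,
    ← lintegral_sub_left_eq_self ((Ioi (0 : ℝ)).indicator _) p.2]
  refine lintegral_mono_ae ?_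
  filter_upwards [hN] with s hN
  by_cases hs : 0 < p.2 - s
  · rw [indicator_of_mem (mem_Ioi.2 hs)]
    simp only [profileKernel, mul_assoc (v _)]
    have hFs : Measurable fun y => F (y, s) := hF.comp measurable_prodMk_right
    have hh : Measurable fun y => ENNReal.ofReal (heatKernel c (p.1 - y) (p.2 - s)) :=
      (measurable_heatKernel (by fun_prop) (by fun_prop) (by fun_prop)).ennreal_ofReal
    rw [lintegral_const_mul _ (by fun_prop)]
    gcongr
    refine (ENNReal.pow_le_pow_left_iff two_ne_zero).1 ?_
    refine (sq_lintegral_mul_le _ hh.aemeasurable hFs.aemeasurable).trans ?_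
    rw [mul_pow]
    refine mul_le_mul' ((lintegral_sq_heatKernel_le hc hs _).trans (le_of_eq ?_)) hN
    rw [← ENNReal.ofReal_pow (by positivity), mul_pow, ← Real.rpow_natCast, ← Real.rpow_natCast,
      ← Real.rpow_mul (by positivity), ← Real.rpow_mul hs.le, Real.sqrt_eq_rpow,
      ← Real.rpow_neg (by positivity)]
    norm_num
  · rw [indicator_of_notMem (by simpa using hs)]
    refine (le_of_eq ((lintegral_congr fun y => ?_).trans lintegral_zero))
    rw [profileKernel_of_le hc.le v (sub_nonpos.1 (not_lt.1 hs)), zero_mul]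

/-! ### Causal kernels dominated by profile kernels -/

/-- The pairs (point, source point) in `ℝ × [0,T]` with the source strictly earlier. -/
def causal (T : ℝ) : Set ((ℝ × ℝ) × (ℝ × ℝ)) :=
  {z | 0 ≤ z.2.2 ∧ z.2.2 < z.1.2 ∧ z.1.2 ≤ T}

lemma measurableSet_causal (T : ℝ) : MeasurableSet (causal T) := by
  unfold causal
  measurability

/-- Composition of space-time kernels. -/
noncomputable def kernelComp (N₁ N₂ : ℝ × ℝ → ℝ × ℝ → ℝ) (p q : ℝ × ℝ) : ℝ :=
  ∫ r, N₁ p r * N₂ r q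

/-- A measurable kernel that vanishes off `causal T` and is dominated by a profile kernel. -/
structure IsDominated (c T : ℝ) (u : ℝ → ℝ≥0∞) (N : ℝ × ℝ → ℝ × ℝ → ℝ) : Prop where
  measurable : Measurable (Function.uncurry N)
  eq_zero : ∀ p q, (p, q) ∉ causal T → N p q = 0
  enorm_le : ∀ p q, ‖N p q‖ₑ ≤ profileKernel c u p q

namespace IsDominated

variable {c T : ℝ} {u v u' : ℝ → ℝ≥0∞} {N N₁ N₂ N' : ℝ × ℝ → ℝ × ℝ → ℝ}

lemma measurable_left (h : IsDominated c T u N) (q : ℝ × ℝ) : Measurable (fun p => N p q) :=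
  h.measurable.comp measurable_prodMk_right

lemma measurable_right (h : IsDominated c T u N) (p : ℝ × ℝ) : Measurable (N p) :=
  h.measurable.comp measurable_prodMk_left

lemma mono (h : IsDominated c T u N) (huv : ∀ t, 0 < t → t ≤ T → u t ≤ v t) :
    IsDominated c T v N where
  measurable := h.measurable
  eq_zero := h.eq_zero
  enorm_le p q := by
    by_cases hpq : (p, q) ∈ causal T
    · obtain ⟨h0, h1, h2⟩ := hpq
      simp only at h0 h1 h2
      exact (h.enorm_le p q).trans
        (profileKernel_mono (huv _ (sub_pos.2 h1) (by linarith)))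
    · simp [h.eq_zero p q hpq]

lemma add (h₁ : IsDominated c T u N₁) (h₂ : IsDominated c T v N₂) :
    IsDominated c T (fun t => u t + v t) (fun p q => N₁ p q + N₂ p q) where
  measurable := h₁.measurable.add h₂.measurable
  eq_zero p q h := by simp [h₁.eq_zero p q h, h₂.eq_zero p q h]
  enorm_le p q := by
    refine (enorm_add_le _ _).trans ?_
    rw [profileKernel, add_mul]
    exact add_le_add (h₁.enorm_le p q) (h₂.enorm_le p q)

lemma measurable_mul (h₁ : IsDominated c T u N₁) (h₂ : IsDominated c T v N₂) (p q : ℝ × ℝ) :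
    Measurable (fun r => N₁ p r * N₂ r q) :=
  (h₁.measurable_right p).mul (h₂.measurable_left q)

lemma mul_eq_zero (h₁ : IsDominated c T u N₁) (h₂ : IsDominated c T v N₂) {p q r : ℝ × ℝ}
    (hr : r.2 ∉ Ioo q.2 p.2) : N₁ p r * N₂ r q = 0 := by
  by_cases h : q.2 < r.2
  · rw [h₁.eq_zero p r fun h' => hr ⟨h, h'.2.1⟩, zero_mul]
  · rw [h₂.eq_zero r q fun h' => h h'.2.1, mul_zero]

lemma lintegral_enorm_mul_le (hc : 0 < c) (hu : Measurable u) (hv : Measurable v)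
    (h₁ : IsDominated c T u N₁) (h₂ : IsDominated c T v N₂) (p q : ℝ × ℝ) :
    ∫⁻ r, ‖N₁ p r * N₂ r q‖ₑ ≤ profileKernel c (timeConv u v) p q := by
  rw [← lintegral_profileKernel_mul hc hu hv]
  refine lintegral_mono fun r => ?_
  rw [enorm_mul]
  exact mul_le_mul' (h₁.enorm_le p r) (h₂.enorm_le r q)

lemma lintegral_slice_enorm_mul_le (hc : 0 < c)
    (h₁ : IsDominated c T u N₁) (h₂ : IsDominated c T v N₂) (p q : ℝ × ℝ) (s : ℝ) :
    ∫⁻ y, ‖N₁ p (y, s) * N₂ (y, s) q‖ₑ ≤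
      (Ioo q.2 p.2).indicator (fun s => u (p.2 - s) * v (s - q.2)) s *
        ENNReal.ofReal (heatKernel c (p.1 - q.1) (p.2 - q.2)) := by
  rw [← lintegral_slice_profileKernel_mul hc]
  refine lintegral_mono fun r => ?_
  rw [enorm_mul]
  exact mul_le_mul' (h₁.enorm_le p _) (h₂.enorm_le _ q)

lemma integrable_mul (hc : 0 < c) (hu : Measurable u) (hv : Measurable v)
    (h₁ : IsDominated c T u N₁) (h₂ : IsDominated c T v N₂) {p q : ℝ × ℝ}
    (h : timeConv u v (p.2 - q.2) ≠ ∞) : Integrable (fun r => N₁ p r * N₂ r q) :=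
  ⟨(h₁.measurable_mul h₂ p q).aestronglyMeasurable,
    (lintegral_enorm_mul_le hc hu hv h₁ h₂ p q).trans_lt (profileKernel_ne_top h).lt_top⟩

lemma comp (hc : 0 < c) (hu : Measurable u) (hv : Measurable v)
    (h₁ : IsDominated c T u N₁) (h₂ : IsDominated c T v N₂) :
    IsDominated c T (timeConv u v) (kernelComp N₁ N₂) where
  measurable := by
    have h : Measurable (fun z : ((ℝ × ℝ) × (ℝ × ℝ)) × (ℝ × ℝ) =>
        N₁ z.1.1 z.2 * N₂ z.2 z.1.2) :=
      (h₁.measurable.comp (by fun_prop : Measurable fun z : ((ℝ × ℝ) × (ℝ × ℝ)) × (ℝ × ℝ) =>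
        (z.1.1, z.2))).mul
      (h₂.measurable.comp (by fun_prop : Measurable fun z : ((ℝ × ℝ) × (ℝ × ℝ)) × (ℝ × ℝ) =>
        (z.2, z.1.2)))
    exact (h.stronglyMeasurable.integral_prod_right' (ν := volume)).measurable
  eq_zero p q h := by
    refine (integral_congr_ae (Filter.Eventually.of_forall fun r => ?_)).trans
      (integral_zero _ _)
    by_cases h1 : (p, r) ∈ causal T
    · have h2 : (r, q) ∉ causal T := fun h2 => h ⟨h2.1, h2.2.1.trans h1.2.1, h1.2.2⟩
      simp [h₂.eq_zero r q h2]
    · simp [h₁.eq_zero p r h1]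
  enorm_le p q := (enorm_integral_le_lintegral_enorm _).trans
    (lintegral_enorm_mul_le hc hu hv h₁ h₂ p q)

lemma kernelComp_eq_integral (hc : 0 < c) (hu : Measurable u) (hv : Measurable v)
    (h₁ : IsDominated c T u N₁) (h₂ : IsDominated c T v N₂) {p q : ℝ × ℝ}
    (h : timeConv u v (p.2 - q.2) ≠ ∞) :
    kernelComp N₁ N₂ p q = ∫ s, ∫ y, N₁ p (y, s) * N₂ (y, s) q := by
  have hint := integrable_mul hc hu hv h₁ h₂ h
  rw [kernelComp]
  rw [Measure.volume_eq_prod] at hint ⊢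
  exact integral_prod_symm _ hint

lemma kernelComp_eq_intervalIntegral (hc : 0 < c) (hu : Measurable u) (hv : Measurable v)
    (h₁ : IsDominated c T u N₁) (h₂ : IsDominated c T v N₂) {p q : ℝ × ℝ}
    (h : timeConv u v (p.2 - q.2) ≠ ∞) (hpq : q.2 < p.2) :
    kernelComp N₁ N₂ p q = ∫ s in q.2..p.2, ∫ y, N₁ p (y, s) * N₂ (y, s) q := by
  rw [kernelComp_eq_integral hc hu hv h₁ h₂ h, intervalIntegral.integral_of_le hpq.le,
    integral_Ioc_eq_integral_Ioo, ← integral_indicator measurableSet_Ioo]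
  refine integral_congr_ae (Filter.Eventually.of_forall fun s => ?_)
  by_cases hs : s ∈ Ioo q.2 p.2
  · simp only [indicator_of_mem hs]
  · simp only [indicator_of_notMem hs, mul_eq_zero h₁ h₂ (r := (_, s)) hs, integral_zero]

/-- The absolute value makes the bound valid for every `t`; for `t ≤ 0` the kernel vanishes. -/
lemma ofReal_heatKernel_le (hc : 0 < c) (x t : ℝ) :
    ENNReal.ofReal (heatKernel c x t) ≤
      ENNReal.ofReal ((Real.sqrt (4 * Real.pi * c))⁻¹ * |t| ^ (-(1 / 2) : ℝ)) := by
  refine ENNReal.ofReal_le_ofReal ?_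
  rcases le_or_gt t 0 with h | h
  · rw [heatKernel_of_nonpos hc.le h]
    positivity
  · rw [abs_of_pos h]
    exact heatKernel_le hc h x

lemma lintegral_slice_enorm_le (hc : 0 < c) (h : IsDominated c T u N) (q : ℝ × ℝ) (s : ℝ) :
    ∫⁻ y, ‖N (y, s) q‖ₑ ≤ u (s - q.2) := by
  rcases le_or_gt s q.2 with hs | hs
  · refine (le_of_eq ((lintegral_congr fun y => ?_).trans lintegral_zero)).trans zero_le
    rw [h.eq_zero _ _ fun h' => absurd h'.2.1 (not_lt.2 hs), enorm_zero]
  · refine (lintegral_mono fun y => h.enorm_le (y, s) q).trans (le_of_eq ?_)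
    simp only [profileKernel]
    rw [lintegral_const_mul _ (measurable_heatKernel (by fun_prop) (by fun_prop)
      (by fun_prop)).ennreal_ofReal, lintegral_heatKernel_sub hc (sub_pos.2 hs), mul_one]

lemma norm_mul_le (hc : 0 < c) (h : IsDominated c T u N) (hu : ∀ t, u t ≠ ∞) (x t y s : ℝ)
    (b : ℝ) : ‖N (x, t) (y, s) * b‖ ≤ (u (t - s) * ENNReal.ofReal
      ((Real.sqrt (4 * Real.pi * c))⁻¹ * |t - s| ^ (-(1 / 2) : ℝ))).toReal * ‖b‖ := by
  rw [norm_mul]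
  gcongr
  rw [← toReal_enorm]
  refine ENNReal.toReal_mono (ENNReal.mul_ne_top (hu _) ENNReal.ofReal_ne_top)
    ((h.enorm_le _ _).trans ?_)
  exact mul_le_mul_right (ofReal_heatKernel_le hc _ _) _

/-- Differentiation in the space variable of the composition of two kernels. The derivative is
first taken at a fixed intermediate time, since the singularity in time of the derivative is
integrable only after integration in space. -/
lemma hasDerivAt_kernelComp (hc : 0 < c) (hu : Measurable u) (hu' : Measurable u')
    (hv : Measurable v) (hu_top : ∀ t, u t ≠ ∞) (hu'_top : ∀ t, u' t ≠ ∞)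
    (hv_top : ∀ t, v t ≠ ∞)
    (h₁ : IsDominated c T u N₁) (h' : IsDominated c T u' N') (h₂ : IsDominated c T v N₂)
    (hderiv : ∀ x t r, HasDerivAt (fun x => N₁ (x, t) r) (N' (x, t) r) x) {t : ℝ} {q : ℝ × ℝ}
    (htop : timeConv u v (t - q.2) ≠ ∞) (htop' : timeConv u' v (t - q.2) ≠ ∞) (x : ℝ) :
    HasDerivAt (fun x => kernelComp N₁ N₂ (x, t) q) (kernelComp N' N₂ (x, t) q) x := by
  simp_rw [kernelComp_eq_integral hc hu hv h₁ h₂ (p := (_, t)) htop,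
    kernelComp_eq_integral hc hu' hv h' h₂ (p := (_, t)) htop']
  have hmeas : ∀ x, StronglyMeasurable fun s => ∫ y, N₁ (x, t) (y, s) * N₂ (y, s) q := fun x =>
    ((h₁.measurable_mul h₂ (x, t) q).comp measurable_swap).stronglyMeasurable.integral_prod_right'
  have hmeas' : ∀ x, StronglyMeasurable fun s => ∫ y, N' (x, t) (y, s) * N₂ (y, s) q := fun x =>
    ((h'.measurable_mul h₂ (x, t) q).comp measurable_swap).stronglyMeasurable.integral_prod_right'
  -- At a fixed intermediate time, `N'` is bounded uniformly in `x` and `y`, while `N₂` is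
  -- integrable in `y`; their product dominates the difference quotients.
  have hslice : ∀ x s, HasDerivAt (fun x => ∫ y, N₁ (x, t) (y, s) * N₂ (y, s) q)
      (∫ y, N' (x, t) (y, s) * N₂ (y, s) q) x := by
    intro x s
    have hN₂ : Integrable fun y => N₂ (y, s) q :=
      ⟨((h₂.measurable_left q).comp measurable_prodMk_right).aestronglyMeasurable,
        (lintegral_slice_enorm_le hc h₂ q s).trans_lt (hv_top _).lt_top⟩
    have hm : ∀ x, Measurable fun y => N₁ (x, t) (y, s) * N₂ (y, s) q := fun x =>
      (h₁.measurable_mul h₂ (x, t) q).comp measurable_prodMk_right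
    have hm' : ∀ x, Measurable fun y => N' (x, t) (y, s) * N₂ (y, s) q := fun x =>
      (h'.measurable_mul h₂ (x, t) q).comp measurable_prodMk_right
    exact (hasDerivAt_integral_of_dominated_loc_of_deriv_le (s := univ) Filter.univ_mem
      (Filter.Eventually.of_forall fun x => (hm x).aestronglyMeasurable)
      ((hN₂.norm.const_mul _).mono' (hm x).aestronglyMeasurable
        (Filter.Eventually.of_forall fun y => h₁.norm_mul_le hc hu_top x t y s (N₂ (y, s) q)))
      (hm' x).aestronglyMeasurable
      (Filter.Eventually.of_forall fun y z _ => h'.norm_mul_le hc hu'_top z t y s (N₂ (y, s) q))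
      (hN₂.norm.const_mul _)
      (Filter.Eventually.of_forall fun y z _ => (hderiv z t (y, s)).mul_const (N₂ (y, s) q))).2
  have hint : Integrable fun s => ∫ y, N₁ (x, t) (y, s) * N₂ (y, s) q := by
    have h := integrable_mul hc hu hv h₁ h₂ (p := (x, t)) htop
    rw [Measure.volume_eq_prod] at h
    exact h.integral_prod_right
  -- Integrating in `y` first leaves `u'(t-s) v(s-τ)` times a Gaussian in `x - ξ`; replacing the
  -- Gaussian by its supremum gives a majorant in `s` independent of `x`.
  set bound : ℝ → ℝ≥0∞ := fun s =>
    (Ioo q.2 t).indicator (fun s => u' (t - s) * v (s - q.2)) s *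
      ENNReal.ofReal ((Real.sqrt (4 * Real.pi * c))⁻¹ * |t - q.2| ^ (-(1 / 2) : ℝ)) with hbound
  have hbm : Measurable bound :=
    (Measurable.indicator (by fun_prop) measurableSet_Ioo).mul_const _
  have hb : ∫⁻ s, bound s ≠ ∞ := by
    rw [lintegral_mul_const _ (Measurable.indicator (by fun_prop) measurableSet_Ioo),
      lintegral_indicator measurableSet_Ioo, timeConv_eq_lintegral_Ioo]
    exact ENNReal.mul_ne_top htop' ENNReal.ofReal_ne_top
  refine (hasDerivAt_integral_of_dominated_loc_of_deriv_le (s := univ)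
    (bound := fun s => (bound s).toReal) Filter.univ_mem
    (Filter.Eventually.of_forall fun x => (hmeas x).aestronglyMeasurable) hint
    (hmeas' x).aestronglyMeasurable ?_
    (integrable_toReal_of_lintegral_ne_top hbm.aemeasurable hb)
    (Filter.Eventually.of_forall fun s z _ => hslice z s)).2
  refine Filter.Eventually.of_forall fun s z _ => ?_
  rw [← toReal_enorm]
  refine ENNReal.toReal_mono ?_ ((enorm_integral_le_lintegral_enorm _).trans
    ((lintegral_slice_enorm_mul_le hc h' h₂ (z, t) q s).trans
      (mul_le_mul_right (ofReal_heatKernel_le hc _ _) _)))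
  refine ENNReal.mul_ne_top ?_ ENNReal.ofReal_ne_top
  by_cases hs : s ∈ Ioo q.2 t
  · rw [indicator_of_mem hs]
    exact ENNReal.mul_ne_top (hu'_top _) (hv_top _)
  · rw [indicator_of_notMem hs]
    exact ENNReal.zero_ne_top

end IsDominated

/-! ### Bounds on the parametrix, its derivative and its error -/

/-- The profile `k t^(-α)`. -/
noncomputable def powerProfile (k α t : ℝ) : ℝ≥0∞ :=
  ENNReal.ofReal k * ENNReal.ofReal (t ^ (-α))

lemma measurable_powerProfile (k α : ℝ) : Measurable (powerProfile k α) := by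
  unfold powerProfile; fun_prop

lemma powerProfile_ne_top (k α t : ℝ) : powerProfile k α t ≠ ∞ :=
  ENNReal.mul_ne_top ENNReal.ofReal_ne_top ENNReal.ofReal_ne_top

lemma timeConv_const_mul {u v : ℝ → ℝ≥0∞} (hu : Measurable u) (hv : Measurable v) (k l : ℝ≥0∞)
    (t : ℝ) : timeConv (fun s => k * u s) (fun s => l * v s) t = k * l * timeConv u v t := by
  rw [timeConv, timeConv, ← lintegral_const_mul _ (by fun_prop)]
  exact lintegral_congr fun s => by ring

lemma exists_timeConv_powerProfile_le {α β k l : ℝ} (hα : 0 ≤ α) (hβ : 0 ≤ β) (hα1 : α < 1)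
    (hβ1 : β < 1) (hk : 0 < k) (hl : 0 < l) :
    ∃ C : ℝ, 0 < C ∧ ∀ t, 0 < t →
      timeConv (powerProfile k α) (powerProfile l β) t ≤ powerProfile C (α + β - 1) t := by
  obtain ⟨C, hC, h⟩ := exists_timeConv_rpow_le hα hβ hα1 hβ1
  refine ⟨k * l * C, by positivity, fun t ht => ?_⟩
  unfold powerProfile
  rw [timeConv_const_mul (by fun_prop) (by fun_prop), ENNReal.ofReal_mul (by positivity),
    ENNReal.ofReal_mul hk.le, mul_assoc (_ * _) (ENNReal.ofReal C), ← ENNReal.ofReal_mul hC.le,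
    show -(α + β - 1) = 1 - α - β by ring]
  exact mul_le_mul_right (h t ht) _

lemma timeConv_of_nonpos (u v : ℝ → ℝ≥0∞) {t : ℝ} (ht : t ≤ 0) : timeConv u v t = 0 := by
  simp [timeConv, Ioo_eq_empty_of_le ht]

lemma timeConv_powerProfile_ne_top {α β k l : ℝ} (hα : 0 ≤ α) (hβ : 0 ≤ β) (hα1 : α < 1)
    (hβ1 : β < 1) (hk : 0 < k) (hl : 0 < l) (t : ℝ) :
    timeConv (powerProfile k α) (powerProfile l β) t ≠ ∞ := by
  rcases le_or_gt t 0 with ht | ht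
  · simp [timeConv_of_nonpos _ _ ht]
  · obtain ⟨C, -, h⟩ := exists_timeConv_powerProfile_le hα hβ hα1 hβ1 hk hl
    exact ne_top_of_le_ne_top (powerProfile_ne_top _ _ _) (h t ht)

/-- A coefficient between `m` and `M`, Hölder continuous of exponent `1/2` on `ℝ × [0,T]`. -/
structure HolderCoeff (a : ℝ × ℝ → ℝ) (m M A T : ℝ) : Prop where
  lower : ∀ p, m ≤ a p
  upper : ∀ p, a p ≤ M
  holder : ∀ p ∈ univ ×ˢ Icc 0 T, ∀ q ∈ univ ×ˢ Icc 0 T,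
    |a p - a q| ≤ A * dist p q ^ (1 / 2 : ℝ)
  continuousOn : ContinuousOn a (univ ×ˢ Icc 0 T)

/-- The parametrix error, cut off outside `causal T`. -/
noncomputable def errorKernel (a : ℝ × ℝ → ℝ) (γ T : ℝ) (p q : ℝ × ℝ) : ℝ :=
  (causal T).indicator (fun z => parametrixError a γ z.1.1 z.1.2 z.2.1 z.2.2) (p, q)

/-- The parametrix, cut off outside `causal T`. -/
noncomputable def baseKernel (a : ℝ × ℝ → ℝ) (T : ℝ) (p q : ℝ × ℝ) : ℝ :=
  (causal T).indicator (fun z => frozenKernel a z.1.1 z.1.2 z.2.1 z.2.2) (p, q)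

/-- The space derivative of the parametrix, cut off outside `causal T`. -/
noncomputable def baseKernelX (a : ℝ × ℝ → ℝ) (T : ℝ) (p q : ℝ × ℝ) : ℝ :=
  (causal T).indicator (fun z => -((z.1.1 - z.2.1) / (2 * a z.2 * (z.1.2 - z.2.2))) *
    frozenKernel a z.1.1 z.1.2 z.2.1 z.2.2) (p, q)

/-- `N'` is a globally measurable stand-in for `N` on causal pairs; `N` itself may fail to be
measurable, since the coefficient is arbitrary off the strip. -/
lemma isDominated_indicator {c T k α : ℝ} (hk : 0 ≤ k)
    {N N' : (ℝ × ℝ) × (ℝ × ℝ) → ℝ} (hN' : Measurable N') (hNN' : EqOn N N' (causal T))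
    (hb : ∀ x t ξ τ, 0 ≤ τ → τ < t → t ≤ T →
      |N ((x, t), (ξ, τ))| ≤ k * (t - τ) ^ (-α) * heatKernel c (x - ξ) (t - τ)) :
    IsDominated c T (powerProfile k α) (fun p q => (causal T).indicator N (p, q)) where
  measurable := by
    have : Function.uncurry (fun p q => (causal T).indicator N (p, q)) =
        (causal T).indicator N' := by
      ext z
      exact congrFun (indicator_congr fun z hz => hNN' hz) z
    rw [this]
    exact hN'.indicator (measurableSet_causal T)
  eq_zero p q h := indicator_of_notMem h _
  enorm_le p q := by
    by_cases h : (p, q) ∈ causal T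
    · rw [indicator_of_mem h, Real.enorm_eq_ofReal_abs, profileKernel, powerProfile,
        ← ENNReal.ofReal_mul hk, ← ENNReal.ofReal_mul]
      · exact ENNReal.ofReal_le_ofReal (hb p.1 p.2 q.1 q.2 h.1 h.2.1 h.2.2)
      · exact mul_nonneg hk (Real.rpow_nonneg (sub_nonneg.2 h.2.1.le) _)
    · rw [indicator_of_notMem h, enorm_zero]
      exact zero_le

namespace HolderCoeff

variable {a : ℝ × ℝ → ℝ} {m M A T : ℝ}

lemma measurable_indicator (h : HolderCoeff a m M A T) :
    Measurable ((univ ×ˢ Icc 0 T).indicator a) := by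
  classical
  rw [← piecewise_eq_indicator]
  exact h.continuousOn.measurable_piecewise continuousOn_const
    (MeasurableSet.univ.prod measurableSet_Icc)

lemma indicator_eq (a : ℝ × ℝ → ℝ) {z : (ℝ × ℝ) × (ℝ × ℝ)} (hz : z ∈ causal T) :
    (univ ×ˢ Icc 0 T).indicator a z.1 = a z.1 ∧ (univ ×ˢ Icc 0 T).indicator a z.2 = a z.2 :=
  ⟨indicator_of_mem (show z.1 ∈ univ ×ˢ Icc 0 T from
      ⟨trivial, hz.1.trans hz.2.1.le, hz.2.2⟩) a,
    indicator_of_mem (show z.2 ∈ univ ×ˢ Icc 0 T from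
      ⟨trivial, hz.1, hz.2.1.le.trans hz.2.2⟩) a⟩

end HolderCoeff

lemma exists_isDominated_baseKernel {m M : ℝ} (hm : 0 < m) (hmM : m ≤ M) :
    ∃ C : ℝ, 0 < C ∧ ∀ (A T : ℝ) (a : ℝ × ℝ → ℝ), HolderCoeff a m M A T →
      IsDominated (2 * M) T (powerProfile C 0) (baseKernel a T) := by
  obtain ⟨C, hC, h⟩ := exists_mul_heatKernel_le hm hmM
  refine ⟨C, hC, fun A T a ha => isDominated_indicator hC.le
    (N' := fun z => heatKernel ((univ ×ˢ Icc 0 T).indicator a z.2) (z.1.1 - z.2.1)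
      (z.1.2 - z.2.2)) ?_ ?_ ?_⟩
  · have := ha.measurable_indicator
    exact measurable_heatKernel (by fun_prop) (by fun_prop) (by fun_prop)
  · intro z hz
    simp only [frozenKernel, (HolderCoeff.indicator_eq a hz).2]
  · intro x t ξ τ h0 h1 h2
    have ht := sub_pos.2 h1
    have hH := heatKernel_nonneg (a (ξ, τ)) (x - ξ) (t - τ)
    have h3 : (1 : ℝ) ≤ (1 + (x - ξ) ^ 2 / (t - τ)) ^ 2 :=
      one_le_pow₀ (le_add_of_nonneg_right (by positivity))
    simp only [frozenKernel, neg_zero, Real.rpow_zero, mul_one]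
    rw [abs_of_nonneg hH]
    exact (le_mul_of_one_le_left hH h3).trans (h _ _ _ (ha.lower _) (ha.upper _) ht)

/-- Trades the factor `x - ξ` of the derivative for half a power of time and a polynomial that the
Gaussian absorbs. -/
lemma abs_le_rpow_mul {z t : ℝ} (ht : 0 < t) : |z| ≤ t ^ (1 / 2 : ℝ) * (1 + z ^ 2 / t) := by
  rw [← Real.sqrt_eq_rpow]
  have hs := Real.sqrt_pos.2 ht
  have h2 : Real.sqrt t * (1 + z ^ 2 / t) = (Real.sqrt t ^ 2 + |z| ^ 2) / Real.sqrt t := by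
    rw [sq_abs]
    nth_rewrite 2 [← Real.sq_sqrt ht.le]
    field_simp
  rw [h2, le_div_iff₀ hs]
  nlinarith [sq_nonneg (Real.sqrt t - |z|), abs_nonneg z]

lemma exists_isDominated_baseKernelX {m M : ℝ} (hm : 0 < m) (hmM : m ≤ M) :
    ∃ C : ℝ, 0 < C ∧ ∀ (A T : ℝ) (a : ℝ × ℝ → ℝ), HolderCoeff a m M A T →
      IsDominated (2 * M) T (powerProfile C (1 / 2)) (baseKernelX a T) := by
  obtain ⟨C, hC, h⟩ := exists_mul_heatKernel_le hm hmM
  refine ⟨1 / (2 * m) * C, by positivity, fun A T a ha =>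
    isDominated_indicator (by positivity)
    (N' := fun z => -((z.1.1 - z.2.1) /
      (2 * (univ ×ˢ Icc 0 T).indicator a z.2 * (z.1.2 - z.2.2))) *
      heatKernel ((univ ×ˢ Icc 0 T).indicator a z.2) (z.1.1 - z.2.1) (z.1.2 - z.2.2)) ?_ ?_ ?_⟩
  · have := ha.measurable_indicator
    exact Measurable.mul (by fun_prop)
      (measurable_heatKernel (by fun_prop) (by fun_prop) (by fun_prop))
  · intro z hz
    simp only [frozenKernel, (HolderCoeff.indicator_eq a hz).2]
  · intro x t ξ τ h0 h1 h2
    have ht := sub_pos.2 h1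
    simp only [frozenKernel]
    set b := a (ξ, τ)
    set z := x - ξ
    set d := t - τ
    have hb : m ≤ b := ha.lower _
    have hb0 : 0 < b := hm.trans_le hb
    have hH := heatKernel_nonneg b z d
    have h3 : 1 + z ^ 2 / d ≤ (1 + z ^ 2 / d) ^ 2 :=
      le_self_pow₀ (le_add_of_nonneg_right (by positivity)) two_ne_zero
    have hd : d⁻¹ * d ^ (1 / 2 : ℝ) = d ^ (-(1 / 2) : ℝ) := by
      rw [← Real.rpow_neg_one, ← Real.rpow_add ht]
      norm_num
    rw [abs_mul, abs_neg, abs_div, abs_of_nonneg hH, abs_of_pos (by positivity : 0 < 2 * b * d)]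
    calc |z| / (2 * b * d) * heatKernel b z d
        ≤ (d ^ (1 / 2 : ℝ) * (1 + z ^ 2 / d) ^ 2) / (2 * m * d) * heatKernel b z d := by
          gcongr
          exact (abs_le_rpow_mul ht).trans (by gcongr)
      _ = 1 / (2 * m) * (d⁻¹ * d ^ (1 / 2 : ℝ)) * ((1 + z ^ 2 / d) ^ 2 * heatKernel b z d) := by
          field_simp
      _ ≤ 1 / (2 * m) * (d⁻¹ * d ^ (1 / 2 : ℝ)) * (C * heatKernel (2 * M) z d) := by
          exact mul_le_mul_of_nonneg_left (h b z d hb (ha.upper _) ht) (by positivity)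
      _ = _ := by rw [hd]; ring

/-- The metric is not parabolic, but `|z| = d^(1/2) (z²/d)^(1/2)` and `d ≤ T₀^(1/2) d^(1/2)`, so
both entries of the maximum are of order `d^(1/2)` up to a factor the Gaussian absorbs. Exponent
`1/2` thus gains `d^(1/4)`. -/
lemma max_rpow_le {z d T₀ : ℝ} (hd : 0 < d) (hdT : d ≤ T₀) :
    (max |z| d) ^ (1 / 2 : ℝ) ≤ (1 + T₀) * d ^ (1 / 4 : ℝ) * (1 + z ^ 2 / d) := by
  have hmax : 0 ≤ max |z| d := le_max_of_le_right hd.le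
  have hr : 0 ≤ z ^ 2 / d := by positivity
  have hT : 0 < T₀ := hd.trans_le hdT
  have h1 : (max |z| d) ^ 2 ≤ d * ((1 + T₀) * (1 + z ^ 2 / d)) := by
    have e : d * ((1 + T₀) * (1 + z ^ 2 / d)) = z ^ 2 + d * T₀ + (d + T₀ * z ^ 2) := by
      field_simp
      ring
    rw [e]
    rcases max_cases |z| d with ⟨h, -⟩ | ⟨h, -⟩ <;> rw [h]
    · rw [sq_abs]
      nlinarith [sq_nonneg z, mul_nonneg hd.le hT.le, mul_nonneg hT.le (sq_nonneg z)]
    · nlinarith [sq_nonneg z, mul_nonneg hT.le (sq_nonneg z)]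
  have h2 : (max |z| d) ^ (1 / 2 : ℝ) = ((max |z| d) ^ 2) ^ (1 / 4 : ℝ) := by
    rw [← Real.rpow_natCast, ← Real.rpow_mul hmax]
    norm_num
  have h3 : 1 ≤ (1 + T₀) * (1 + z ^ 2 / d) := by nlinarith [mul_nonneg hT.le hr]
  calc (max |z| d) ^ (1 / 2 : ℝ) ≤ (d * ((1 + T₀) * (1 + z ^ 2 / d))) ^ (1 / 4 : ℝ) := by
        rw [h2]; gcongr
    _ = d ^ (1 / 4 : ℝ) * ((1 + T₀) * (1 + z ^ 2 / d)) ^ (1 / 4 : ℝ) := by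
        rw [Real.mul_rpow hd.le (by positivity)]
    _ ≤ d ^ (1 / 4 : ℝ) * ((1 + T₀) * (1 + z ^ 2 / d)) := by
        gcongr
        exact Real.rpow_le_self_of_one_le h3 (by norm_num)
    _ = _ := by ring

lemma exists_isDominated_errorKernel {m M A T₀ γ : ℝ} (hm : 0 < m) (hmM : m ≤ M) (hA : 0 ≤ A)
    (hγ : 0 < γ) (hT₀ : 0 < T₀) :
    ∃ C : ℝ, 0 < C ∧ ∀ T ≤ T₀, ∀ a : ℝ × ℝ → ℝ, HolderCoeff a m M A T →
      IsDominated (2 * M) T (powerProfile C (3 / 4)) (errorKernel a γ T) := by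
  obtain ⟨C, hC, h⟩ := exists_mul_heatKernel_le hm hmM
  refine ⟨(A * (1 + T₀) * (1 / (4 * m ^ 2) + 1 / (2 * m)) + γ * (1 + T₀)) * C, by positivity,
    fun T hT a ha => isDominated_indicator (by positivity)
    (N' := fun z => ((univ ×ˢ Icc 0 T).indicator a z.1 - (univ ×ˢ Icc 0 T).indicator a z.2) *
      ((z.1.1 - z.2.1) ^ 2 / (2 * (univ ×ˢ Icc 0 T).indicator a z.2 * (z.1.2 - z.2.2)) ^ 2
        - 1 / (2 * (univ ×ˢ Icc 0 T).indicator a z.2 * (z.1.2 - z.2.2))) *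
      heatKernel ((univ ×ˢ Icc 0 T).indicator a z.2) (z.1.1 - z.2.1) (z.1.2 - z.2.2)
      - γ * heatKernel ((univ ×ˢ Icc 0 T).indicator a z.2) (z.1.1 - z.2.1)
        (z.1.2 - z.2.2)) ?_ ?_ ?_⟩
  · have := ha.measurable_indicator
    exact (Measurable.mul (by fun_prop)
      (measurable_heatKernel (by fun_prop) (by fun_prop) (by fun_prop))).sub
      (Measurable.const_mul (measurable_heatKernel (by fun_prop) (by fun_prop) (by fun_prop)) _)
  · intro z hz
    simp only [HolderCoeff.indicator_eq a hz]
    exact parametrixError_eq (hm.trans_le (ha.lower _)) hz.2.1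
  · intro x t ξ τ h0 h1 h2
    have hd : 0 < t - τ := sub_pos.2 h1
    have hdT : t - τ ≤ T₀ := by linarith
    simp only []
    rw [parametrixError_eq (hm.trans_le (ha.lower _)) h1]
    have hdiff : |a (x, t) - a (ξ, τ)| ≤
        A * ((1 + T₀) * (t - τ) ^ (1 / 4 : ℝ) * (1 + (x - ξ) ^ 2 / (t - τ))) := by
      refine (ha.holder (x, t) ⟨trivial, by linarith, h2⟩ (ξ, τ)
        ⟨trivial, h0, by linarith⟩).trans ?_
      gcongr
      rw [Prod.dist_eq, Real.dist_eq, Real.dist_eq, abs_of_pos hd]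
      exact max_rpow_le hd hdT
    set b := a (ξ, τ)
    set z := x - ξ
    set d := t - τ
    have hb : m ≤ b := ha.lower _
    have hb0 : 0 < b := hm.trans_le hb
    have hH := heatKernel_nonneg b z d
    have hr : 0 ≤ z ^ 2 / d := by positivity
    have h3 : |z ^ 2 / (2 * b * d) ^ 2 - 1 / (2 * b * d)| ≤
        d⁻¹ * ((1 / (4 * m ^ 2) + 1 / (2 * m)) * (1 + z ^ 2 / d)) := by
      calc |z ^ 2 / (2 * b * d) ^ 2 - 1 / (2 * b * d)|
          ≤ z ^ 2 / (2 * b * d) ^ 2 + 1 / (2 * b * d) := by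
            refine (abs_sub _ _).trans (le_of_eq ?_)
            rw [abs_of_nonneg (by positivity), abs_of_nonneg (by positivity)]
        _ ≤ z ^ 2 / (2 * m * d) ^ 2 + 1 / (2 * m * d) := by gcongr
        _ = d⁻¹ * (1 / (4 * m ^ 2) * (z ^ 2 / d) + 1 / (2 * m) * 1) := by
            field_simp
            ring
        _ ≤ d⁻¹ * (1 / (4 * m ^ 2) * (1 + z ^ 2 / d) + 1 / (2 * m) * (1 + z ^ 2 / d)) := by
            gcongr <;> linarith
        _ = _ := by ring
    have hpow : d ^ (1 / 4 : ℝ) * d⁻¹ = d ^ (-(3 / 4) : ℝ) := by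
      rw [← Real.rpow_neg_one, ← Real.rpow_add hd]
      norm_num
    -- The zero-order term has no singularity in time; this places it under the common profile
    -- `d^(-3/4)`.
    have hone : 1 ≤ (1 + T₀) * d ^ (-(3 / 4) : ℝ) := by
      have h4 : d ^ (3 / 4 : ℝ) ≤ 1 + T₀ := by
        calc d ^ (3 / 4 : ℝ) ≤ (1 + T₀) ^ (3 / 4 : ℝ) := by gcongr; linarith
          _ ≤ 1 + T₀ := Real.rpow_le_self_of_one_le (by linarith) (by norm_num)
      rw [Real.rpow_neg hd.le, ← div_eq_mul_inv, le_div_iff₀ (by positivity), one_mul]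
      exact h4
    have h5 : (1 : ℝ) ≤ (1 + z ^ 2 / d) ^ 2 := one_le_pow₀ (by linarith)
    calc _ ≤ |a (x, t) - b| * |z ^ 2 / (2 * b * d) ^ 2 - 1 / (2 * b * d)| * heatKernel b z d
          + 1 * (γ * (1 * heatKernel b z d)) := by
          refine (abs_sub _ _).trans (le_of_eq ?_)
          rw [abs_mul, abs_mul, abs_of_nonneg hH, abs_mul, abs_of_nonneg hH, abs_of_pos hγ]
          ring
      _ ≤ (A * ((1 + T₀) * d ^ (1 / 4 : ℝ) * (1 + z ^ 2 / d))) *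
            (d⁻¹ * ((1 / (4 * m ^ 2) + 1 / (2 * m)) * (1 + z ^ 2 / d))) * heatKernel b z d
          + (1 + T₀) * d ^ (-(3 / 4) : ℝ) * (γ * ((1 + z ^ 2 / d) ^ 2 * heatKernel b z d)) := by
          gcongr
      _ = (A * (1 + T₀) * (1 / (4 * m ^ 2) + 1 / (2 * m)) * (d ^ (1 / 4 : ℝ) * d⁻¹) +
            γ * (1 + T₀) * d ^ (-(3 / 4) : ℝ)) *
            ((1 + z ^ 2 / d) ^ 2 * heatKernel b z d) := by ring
      _ ≤ (A * (1 + T₀) * (1 / (4 * m ^ 2) + 1 / (2 * m)) * (d ^ (1 / 4 : ℝ) * d⁻¹) +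
            γ * (1 + T₀) * d ^ (-(3 / 4) : ℝ)) * (C * heatKernel (2 * M) z d) := by
          exact mul_le_mul_of_nonneg_left (h b z d hb (ha.upper _) hd) (by positivity)
      _ = _ := by rw [hpow]; ring

/-! ### Convergence of the Neumann series -/

/-- The iterates of the cut-off parametrix error under composition. -/
noncomputable def iterKernel (a : ℝ × ℝ → ℝ) (γ T : ℝ) : ℕ → ℝ × ℝ → ℝ × ℝ → ℝ
  | 0 => errorKernel a γ T
  | n + 1 => kernelComp (errorKernel a γ T) (iterKernel a γ T n)

/-- The Neumann series of the cut-off parametrix error. -/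
noncomputable def densityKernel (a : ℝ × ℝ → ℝ) (γ T : ℝ) (p q : ℝ × ℝ) : ℝ :=
  ∑' n, iterKernel a γ T n p q

/-- The profile `k t^(-3/4) e^(l t)`. -/
noncomputable def expProfile (k : ℝ≥0∞) (l t : ℝ) : ℝ≥0∞ :=
  k * ENNReal.ofReal (t ^ (-(3 / 4) : ℝ) * Real.exp (l * t))

lemma measurable_expProfile (k : ℝ≥0∞) (l : ℝ) : Measurable (expProfile k l) := by
  unfold expProfile; fun_prop

/-- Geometric decay of the iterated kernels, in an exponentially weighted profile. -/
lemma exists_isDominated_iterKernel {c C : ℝ} (hc : 0 < c) (hC : 0 < C) :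
    ∃ l : ℝ, 0 < l ∧ ∀ (a : ℝ × ℝ → ℝ) (γ T : ℝ),
      IsDominated c T (powerProfile C (3 / 4)) (errorKernel a γ T) → ∀ n,
        IsDominated c T (expProfile (ENNReal.ofReal C * 2⁻¹ ^ n) l) (iterKernel a γ T n) := by
  -- With `ε = 1/(2C)`, each composition with the error, of constant `C`, multiplies the weighted
  -- bound by `C ε = 1/2`.
  obtain ⟨l, hl, h⟩ := exists_timeConv_exp_le (β := 3 / 4) (ε := 1 / (2 * C))
    (by norm_num) (by norm_num) (by positivity)
  refine ⟨l, hl, fun a γ T ha n => ?_⟩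
  induction n with
  | zero =>
    refine ha.mono fun t ht _ => ?_
    rw [powerProfile, expProfile, pow_zero, mul_one]
    refine mul_le_mul_right (ENNReal.ofReal_le_ofReal ?_) _
    exact le_mul_of_one_le_right (by positivity) (Real.one_le_exp (by positivity))
  | succ n ih =>
    refine (ha.comp hc (measurable_powerProfile _ _) (measurable_expProfile _ _) ih).mono
      fun t ht _ => ?_
    unfold powerProfile expProfile
    rw [timeConv_const_mul (by fun_prop) (by fun_prop)]
    refine (mul_le_mul_right (h t ht) _).trans (le_of_eq ?_)
    have e : ENNReal.ofReal C * ENNReal.ofReal (1 / (2 * C)) = 2⁻¹ := by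
      rw [← ENNReal.ofReal_mul hC.le, ← ENNReal.ofReal_ofNat 2,
        ← ENNReal.ofReal_inv_of_pos two_pos]
      congr 1
      field_simp
    calc _ = (ENNReal.ofReal C * ENNReal.ofReal (1 / (2 * C))) * (ENNReal.ofReal C * 2⁻¹ ^ n *
          ENNReal.ofReal (t ^ (-(3 / 4) : ℝ) * Real.exp (l * t))) := by ring
      _ = _ := by rw [e, pow_succ]; ring

lemma expProfile_le {k : ℝ≥0∞} {l t T₀ : ℝ} (hl : 0 < l) (ht : 0 < t) (htT : t ≤ T₀) :
    expProfile k l t ≤ k * ENNReal.ofReal (Real.exp (l * T₀)) *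
      ENNReal.ofReal (t ^ (-(3 / 4) : ℝ)) := by
  rw [expProfile, mul_assoc, ← ENNReal.ofReal_mul (Real.exp_pos _).le, mul_comm (Real.exp _)]
  gcongr

/-- Uniform domination of the iterated kernels, and of their sum. -/
lemma exists_isDominated_densityKernel {c C T₀ : ℝ} (hc : 0 < c) (hC : 0 < C) :
    ∃ C' : ℝ, 0 < C' ∧ ∀ (a : ℝ × ℝ → ℝ) (γ T : ℝ), T ≤ T₀ →
      IsDominated c T (powerProfile C (3 / 4)) (errorKernel a γ T) →
        (∀ n, IsDominated c T (powerProfile C' (3 / 4)) (iterKernel a γ T n)) ∧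
        (∀ p q, Summable fun n => ‖iterKernel a γ T n p q‖) ∧
        IsDominated c T (powerProfile C' (3 / 4)) (densityKernel a γ T) := by
  obtain ⟨l, hl, h⟩ := exists_isDominated_iterKernel hc hC
  -- The factor `2` is the sum of the geometric series, and the exponential weight is at most its
  -- value at `T₀`.
  refine ⟨2 * C * Real.exp (l * T₀), by positivity, fun a γ T hT ha => ?_⟩
  have hn := h a γ T ha
  have hsum : ∀ p q, ∑' n, ‖iterKernel a γ T n p q‖ₑ ≤
      profileKernel c (expProfile (2 * ENNReal.ofReal C) l) p q := by
    intro p q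
    refine (ENNReal.tsum_le_tsum fun n => (hn n).enorm_le p q).trans (le_of_eq ?_)
    have e : ∀ n : ℕ, profileKernel c (expProfile (ENNReal.ofReal C * 2⁻¹ ^ n) l) p q =
        2⁻¹ ^ n * profileKernel c (expProfile (ENNReal.ofReal C) l) p q := fun n => by
      simp only [profileKernel, expProfile]; ring
    simp_rw [e]
    rw [ENNReal.tsum_mul_right, ENNReal.tsum_geometric, ENNReal.one_sub_inv_two, inv_inv]
    simp only [profileKernel, expProfile]; ring
  have htop : ∀ p q, ∑' n, ‖iterKernel a γ T n p q‖ₑ ≠ ∞ := fun p q =>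
    ne_top_of_le_ne_top (profileKernel_ne_top
      (ENNReal.mul_ne_top (ENNReal.mul_ne_top (by simp) (by simp)) (by simp))) (hsum p q)
  have hsummable : ∀ p q, Summable fun n => ‖iterKernel a γ T n p q‖ := fun p q => by
    simpa using ENNReal.summable_toReal (htop p q)
  have hprofile : ∀ k : ℝ≥0∞, k ≤ 2 * ENNReal.ofReal C → ∀ t, 0 < t → t ≤ T →
      expProfile k l t ≤ powerProfile (2 * C * Real.exp (l * T₀)) (3 / 4) t := by
    intro k hk t ht htT
    refine (expProfile_le hl ht (htT.trans hT)).trans ?_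
    rw [powerProfile, ENNReal.ofReal_mul (by positivity), ENNReal.ofReal_mul (by positivity),
      ENNReal.ofReal_ofNat]
    gcongr
  refine ⟨fun n => (hn n).mono (hprofile _ ?_), hsummable, ?_⟩
  · rw [mul_comm]
    refine mul_le_mul_left ((pow_le_one₀ zero_le ?_).trans one_le_two) _
    simp
  · refine IsDominated.mono (u := expProfile (2 * ENNReal.ofReal C) l) ⟨?_, ?_, ?_⟩
      (hprofile _ le_rfl)
    · have hm : ∀ n, Measurable fun z : (ℝ × ℝ) × (ℝ × ℝ) => iterKernel a γ T n z.1 z.2 :=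
        fun n => (hn n).measurable
      refine measurable_of_tendsto_metrizable
        (f := fun N z => ∑ n ∈ Finset.range N, iterKernel a γ T n z.1 z.2)
        (fun N => Finset.measurable_fun_sum _ fun n _ => hm n) ?_
      rw [tendsto_pi_nhds]
      intro z
      exact (hsummable z.1 z.2).of_norm.hasSum.tendsto_sum_nat
    · intro p q hpq
      simp [densityKernel, fun n => (hn n).eq_zero p q hpq]
    · exact fun p q => enorm_tsum_le_tsum_enorm.trans (hsum p q)

/-! ### Bounds on the kernel and its space derivative -/

/-- The kernel `Γ`, cut off outside `causal T`. -/
noncomputable def gamKernel (a : ℝ × ℝ → ℝ) (γ T : ℝ) (p q : ℝ × ℝ) : ℝ :=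
  baseKernel a T p q + kernelComp (baseKernel a T) (densityKernel a γ T) p q

/-- The space derivative of `Γ`, cut off outside `causal T`. -/
noncomputable def gamKernelX (a : ℝ × ℝ → ℝ) (γ T : ℝ) (p q : ℝ × ℝ) : ℝ :=
  baseKernelX a T p q + kernelComp (baseKernelX a T) (densityKernel a γ T) p q

/-- The bounds on all the kernels of the parametrix construction, with one constant. -/
structure KernelBounds (a : ℝ × ℝ → ℝ) (γ T c C : ℝ) : Prop where
  error : IsDominated c T (powerProfile C (3 / 4)) (errorKernel a γ T)
  iter : ∀ n, IsDominated c T (powerProfile C (3 / 4)) (iterKernel a γ T n)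
  summable : ∀ p q, Summable fun n => ‖iterKernel a γ T n p q‖
  neumann : IsDominated c T (powerProfile C (3 / 4)) (densityKernel a γ T)
  base : IsDominated c T (powerProfile C 0) (baseKernel a T)
  baseX : IsDominated c T (powerProfile C (1 / 2)) (baseKernelX a T)
  gam : IsDominated c T (powerProfile C 0) (gamKernel a γ T)
  gamX : IsDominated c T (powerProfile C (1 / 2)) (gamKernelX a γ T)

lemma powerProfile_mono_left {k k' : ℝ} (h : k ≤ k') (α t : ℝ) :
    powerProfile k α t ≤ powerProfile k' α t :=
  mul_le_mul_left (ENNReal.ofReal_le_ofReal h) _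

/-- Convolving `t^(-α)` with `t^(-3/4)` gives `t^(1/4-α)`: the correction is smaller than the
leading term by `t^(1/4) ≤ T₀^(1/4)`. Used with `α = 0` for `Γ` and `α = 1/2` for `Γₓ`. -/
lemma exists_isDominated_add_kernelComp {c α k l T₀ : ℝ} (hc : 0 < c) (hα : 0 ≤ α) (hα1 : α < 1)
    (hk : 0 < k) (hl : 0 < l) (hT₀ : 0 < T₀) :
    ∃ C : ℝ, 0 < C ∧ ∀ (T : ℝ) (N₁ N₂ : ℝ × ℝ → ℝ × ℝ → ℝ), T ≤ T₀ →
      IsDominated c T (powerProfile k α) N₁ → IsDominated c T (powerProfile l (3 / 4)) N₂ →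
        IsDominated c T (powerProfile C α) (fun p q => N₁ p q + kernelComp N₁ N₂ p q) := by
  obtain ⟨C, hC, h⟩ := exists_timeConv_powerProfile_le (β := 3 / 4) hα (by norm_num) hα1
    (by norm_num) hk hl
  refine ⟨k + C * T₀ ^ (1 / 4 : ℝ), by positivity, fun T N₁ N₂ hT h₁ h₂ => ?_⟩
  refine (h₁.add (h₁.comp hc (measurable_powerProfile _ _) (measurable_powerProfile _ _)
    h₂)).mono fun t ht htT => ?_
  refine (add_le_add_right (h t ht) _).trans ?_
  simp only [powerProfile]
  rw [ENNReal.ofReal_add hk.le (by positivity), add_mul]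
  refine add_le_add_right ?_ _
  rw [← ENNReal.ofReal_mul hC.le, ← ENNReal.ofReal_mul (by positivity), mul_assoc]
  gcongr
  rw [show -(α + 3 / 4 - 1) = 1 / 4 + -α by ring, Real.rpow_add ht]
  gcongr
  exact htT.trans hT

lemma exists_kernelBounds {m M A T₀ γ : ℝ} (hm : 0 < m) (hmM : m ≤ M) (hA : 0 ≤ A)
    (hγ : 0 < γ) (hT₀ : 0 < T₀) :
    ∃ C : ℝ, 0 < C ∧ ∀ T ≤ T₀, ∀ a : ℝ × ℝ → ℝ, HolderCoeff a m M A T →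
      KernelBounds a γ T (2 * M) C := by
  have hc : 0 < 2 * M := by linarith
  obtain ⟨C₁, hC₁, h₁⟩ := exists_isDominated_errorKernel hm hmM hA hγ hT₀
  obtain ⟨C₂, hC₂, h₂⟩ := exists_isDominated_densityKernel (T₀ := T₀) hc hC₁
  obtain ⟨C₃, hC₃, h₃⟩ := exists_isDominated_baseKernel hm hmM
  obtain ⟨C₄, hC₄, h₄⟩ := exists_isDominated_baseKernelX hm hmM
  obtain ⟨C₅, hC₅, h₅⟩ := exists_isDominated_add_kernelComp (α := 0) hc le_rfl one_pos hC₃ hC₂ hT₀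
  obtain ⟨C₆, hC₆, h₆⟩ := exists_isDominated_add_kernelComp (α := 1 / 2) hc (by norm_num)
    (by norm_num) hC₄ hC₂ hT₀
  refine ⟨C₁ + C₂ + C₃ + C₄ + C₅ + C₆, by positivity, fun T hT a ha => ?_⟩
  have e₁ := h₁ T hT a ha
  obtain ⟨e₂, e₂', e₂''⟩ := h₂ a γ T hT e₁
  have e₃ := h₃ A T a ha
  have e₄ := h₄ A T a ha
  exact
    { error := e₁.mono fun t _ _ => powerProfile_mono_left (by linarith) _ _
      iter := fun n => (e₂ n).mono fun t _ _ => powerProfile_mono_left (by linarith) _ _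
      summable := e₂'
      neumann := e₂''.mono fun t _ _ => powerProfile_mono_left (by linarith) _ _
      base := e₃.mono fun t _ _ => powerProfile_mono_left (by linarith) _ _
      baseX := e₄.mono fun t _ _ => powerProfile_mono_left (by linarith) _ _
      gam := (h₅ T _ _ hT e₃ e₂'').mono fun t _ _ => powerProfile_mono_left (by linarith) _ _
      gamX := (h₆ T _ _ hT e₄ e₂'').mono fun t _ _ => powerProfile_mono_left (by linarith) _ _ }

/-! ### Identification of the cut-off kernels with the parametrix construction -/

namespace KernelBounds

variable {a : ℝ × ℝ → ℝ} {γ T c C : ℝ}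

lemma errorKernel_eq {x t ξ τ : ℝ} (h0 : 0 ≤ τ) (h1 : τ < t) (h2 : t ≤ T) :
    errorKernel a γ T (x, t) (ξ, τ) = parametrixError a γ x t ξ τ :=
  indicator_of_mem (show ((x, t), (ξ, τ)) ∈ causal T from ⟨h0, h1, h2⟩) _

lemma baseKernel_eq {x t ξ τ : ℝ} (h0 : 0 ≤ τ) (h1 : τ < t) (h2 : t ≤ T) :
    baseKernel a T (x, t) (ξ, τ) = frozenKernel a x t ξ τ :=
  indicator_of_mem (show ((x, t), (ξ, τ)) ∈ causal T from ⟨h0, h1, h2⟩) _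

lemma intervalIntegral_congr_Ioo {f g : ℝ → ℝ} {τ t : ℝ} (h : τ ≤ t) (hfg : EqOn f g (Ioo τ t)) :
    ∫ s in τ..t, f s = ∫ s in τ..t, g s := by
  rw [intervalIntegral.integral_of_le h, intervalIntegral.integral_of_le h,
    integral_Ioc_eq_integral_Ioo, integral_Ioc_eq_integral_Ioo]
  exact setIntegral_congr_fun measurableSet_Ioo hfg

/-- An intermediate time in `(τ,t)` makes both factors causal, so the cut-offs are invisible there.
Finiteness of the time convolution gives Fubini, which turns the joint integral into the iterated
one. The induction varies the first point, since inner iterates start at intermediate points. -/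
lemma iterKernel_eq (h : KernelBounds a γ T c C) (hc : 0 < c) (hC : 0 < C) (n : ℕ)
    {x t ξ τ : ℝ} (h0 : 0 ≤ τ) (h1 : τ < t) (h2 : t ≤ T) :
    iterKernel a γ T n (x, t) (ξ, τ) = iteratedError a γ n x t ξ τ := by
  induction n generalizing x t with
  | zero => exact errorKernel_eq h0 h1 h2
  | succ n ih =>
    rw [iterKernel, IsDominated.kernelComp_eq_intervalIntegral hc (measurable_powerProfile _ _)
      (measurable_powerProfile _ _) h.error (h.iter n) (timeConv_powerProfile_ne_top (by norm_num)
      (by norm_num) (by norm_num) (by norm_num) hC hC _) h1]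
    refine intervalIntegral_congr_Ioo h1.le fun s hs => ?_
    refine integral_congr_ae (Filter.Eventually.of_forall fun y => ?_)
    simp only
    rw [errorKernel_eq (h0.trans hs.1.le) hs.2 h2, ih hs.1 (hs.2.le.trans h2)]

lemma densityKernel_eq (h : KernelBounds a γ T c C) (hc : 0 < c) (hC : 0 < C)
    {x t ξ τ : ℝ} (h0 : 0 ≤ τ) (h1 : τ < t) (h2 : t ≤ T) :
    densityKernel a γ T (x, t) (ξ, τ) = density a γ x t ξ τ :=
  tsum_congr fun n => h.iterKernel_eq hc hC n h0 h1 h2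

lemma gamKernel_eq (h : KernelBounds a γ T c C) (hc : 0 < c) (hC : 0 < C)
    {x t ξ τ : ℝ} (h0 : 0 ≤ τ) (h1 : τ < t) (h2 : t ≤ T) :
    gamKernel a γ T (x, t) (ξ, τ) = Gam a γ x t ξ τ := by
  rw [gamKernel, Gam, baseKernel_eq h0 h1 h2, IsDominated.kernelComp_eq_intervalIntegral hc
    (measurable_powerProfile _ _) (measurable_powerProfile _ _) h.base h.neumann
    (timeConv_powerProfile_ne_top (by norm_num) (by norm_num) (by norm_num) (by norm_num) hC hC _)
    h1]
  congr 1
  refine intervalIntegral_congr_Ioo h1.le fun s hs => ?_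
  refine integral_congr_ae (Filter.Eventually.of_forall fun y => ?_)
  simp only
  rw [baseKernel_eq (h0.trans hs.1.le) hs.2 h2, h.densityKernel_eq hc hC h0 hs.1 (hs.2.le.trans h2)]

/-- Causality constrains only the times, so the cut-off does not move with `x` and creates no
boundary term. -/
lemma hasDerivAt_baseKernel (x t : ℝ) (r : ℝ × ℝ) :
    HasDerivAt (fun x => baseKernel a T (x, t) r) (baseKernelX a T (x, t) r) x := by
  by_cases hr : ((x, t), r) ∈ causal T
  · have hr' : ∀ x, ((x, t), r) ∈ causal T := fun x => hr
    simp only [baseKernel, baseKernelX, indicator_of_mem (hr' _)]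
    exact (hasDerivAt_heatKernel (x - r.1)).comp_sub_const x r.1
  · have hr' : ∀ x, ((x, t), r) ∉ causal T := fun x => hr
    simp only [baseKernel, baseKernelX, indicator_of_notMem (hr' _)]
    exact hasDerivAt_const _ _

lemma hasDerivAt_gamKernel (h : KernelBounds a γ T c C) (hc : 0 < c) (hC : 0 < C) (x t : ℝ)
    (q : ℝ × ℝ) :
    HasDerivAt (fun x => gamKernel a γ T (x, t) q) (gamKernelX a γ T (x, t) q) x := by
  refine (hasDerivAt_baseKernel x t q).add (IsDominated.hasDerivAt_kernelComp hc
    (measurable_powerProfile _ _) (measurable_powerProfile _ _) (measurable_powerProfile _ _)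
    (powerProfile_ne_top _ _) (powerProfile_ne_top _ _) (powerProfile_ne_top _ _)
    h.base h.baseX h.neumann hasDerivAt_baseKernel ?_ ?_ x)
  · exact timeConv_powerProfile_ne_top (by norm_num) (by norm_num) (by norm_num) (by norm_num)
      hC hC _
  · exact timeConv_powerProfile_ne_top (by norm_num) (by norm_num) (by norm_num) (by norm_num)
      hC hC _

lemma hasDerivAt_Gam (h : KernelBounds a γ T c C) (hc : 0 < c) (hC : 0 < C) {t τ : ℝ}
    (x ξ : ℝ) (h0 : 0 ≤ τ) (h1 : τ < t) (h2 : t ≤ T) :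
    HasDerivAt (fun x => Gam a γ x t ξ τ) (gamKernelX a γ T (x, t) (ξ, τ)) x := by
  simpa only [h.gamKernel_eq hc hC h0 h1 h2] using h.hasDerivAt_gamKernel hc hC x t (ξ, τ)

lemma gamKernelX_eq (h : KernelBounds a γ T c C) (hc : 0 < c) (hC : 0 < C)
    {x t ξ τ : ℝ} (h0 : 0 ≤ τ) (h1 : τ < t) (h2 : t ≤ T) :
    gamKernelX a γ T (x, t) (ξ, τ) = GamX a γ x t ξ τ :=
  (h.hasDerivAt_Gam hc hC x ξ h0 h1 h2).deriv.symm

lemma wellDefined (h : KernelBounds a γ T c C) (hc : 0 < c) (hC : 0 < C) :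
    WellDefined a γ T where
  iterated x t ξ τ h0 h1 h2 n := by
    refine (IsDominated.integrable_mul hc (measurable_powerProfile _ _)
      (measurable_powerProfile _ _) h.error (h.iter n) (p := (x, t)) (q := (ξ, τ))
      (timeConv_powerProfile_ne_top (by norm_num) (by norm_num) (by norm_num) (by norm_num)
        hC hC _)).integrableOn.congr_fun ?_ (MeasurableSet.univ.prod measurableSet_Ioo)
    rintro ⟨y, s⟩ ⟨-, hs⟩
    simp only
    rw [errorKernel_eq (h0.trans hs.1.le) hs.2 h2,
      h.iterKernel_eq hc hC n h0 hs.1 (hs.2.le.trans h2)]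
  series x t ξ τ h0 h1 h2 := by
    simpa only [h.iterKernel_eq hc hC _ h0 h1 h2, Real.norm_eq_abs] using
      h.summable (x, t) (ξ, τ)
  correction x t ξ τ h0 h1 h2 := by
    refine (IsDominated.integrable_mul hc (measurable_powerProfile _ _)
      (measurable_powerProfile _ _) h.base h.neumann (p := (x, t)) (q := (ξ, τ))
      (timeConv_powerProfile_ne_top (by norm_num) (by norm_num) (by norm_num) (by norm_num)
        hC hC _)).integrableOn.congr_fun ?_ (MeasurableSet.univ.prod measurableSet_Ioo)
    rintro ⟨y, s⟩ ⟨-, hs⟩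
    simp only
    rw [baseKernel_eq (h0.trans hs.1.le) hs.2 h2,
      h.densityKernel_eq hc hC h0 hs.1 (hs.2.le.trans h2)]
  differentiable x t ξ τ h0 h1 h2 := (h.hasDerivAt_Gam hc hC x ξ h0 h1 h2).differentiableAt

end KernelBounds

/-! ### Norm estimates for dominated kernels -/

lemma eLpNorm_two_sq {α : Type*} [MeasurableSpace α] {μ : Measure α} (f : α → ℝ) :
    eLpNorm f 2 μ ^ 2 = ∫⁻ x, ‖f x‖ₑ ^ 2 ∂μ := by
  have h := eLpNorm_nnreal_pow_eq_lintegral (f := f) (μ := μ) (p := 2) two_ne_zero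
  simpa only [NNReal.coe_ofNat, ENNReal.rpow_ofNat, ENNReal.coe_ofNat] using h

/-- The profile `k t^(-α)`, cut off at time `T`. -/
noncomputable def cutoffProfile (k α T : ℝ) : ℝ → ℝ≥0∞ :=
  (Iic T).indicator (powerProfile k α)

lemma measurable_cutoffProfile (k α T : ℝ) : Measurable (cutoffProfile k α T) :=
  (measurable_powerProfile k α).indicator measurableSet_Iic

lemma lintegral_cutoffProfile {k α T : ℝ} (hk : 0 ≤ k) (hα : α < 1) (hT : 0 ≤ T) :
    ∫⁻ s in Ioi 0, cutoffProfile k α T s = ENNReal.ofReal (k / (1 - α) * T ^ (1 - α)) := by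
  rw [cutoffProfile, lintegral_indicator measurableSet_Iic,
    Measure.restrict_restrict measurableSet_Iic, inter_comm, Ioi_inter_Iic,
    ← setLIntegral_congr Ioo_ae_eq_Ioc]
  unfold powerProfile
  rw [lintegral_const_mul _ (by fun_prop), lintegral_rpow_Ioo hα hT, ← ENNReal.ofReal_mul hk]
  ring_nf

/-- Elapsed times between causal pairs never exceed `T`. Cutting the profile there makes its
integrals over `(0,∞)` finite and produces the powers of `T`. -/
lemma IsDominated.cutoff {c T k α : ℝ} {N : ℝ × ℝ → ℝ × ℝ → ℝ}
    (h : IsDominated c T (powerProfile k α) N) : IsDominated c T (cutoffProfile k α T) N :=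
  h.mono fun t _ ht => by rw [cutoffProfile, indicator_of_mem (mem_Iic.2 ht)]

/-- Here `∫₀ᵀ s^(-1/2) ds = 2 T^(1/2)`; the value is written as a square so that the root can be
taken in the `L² → L^∞` bound. -/
lemma lintegral_cutoffProfile_sq_mul {k c T : ℝ} (hk : 0 ≤ k) (hc : 0 < c) (hT : 0 ≤ T) :
    ∫⁻ s in Ioi 0, cutoffProfile k 0 T s ^ 2 *
      ENNReal.ofReal ((Real.sqrt (4 * Real.pi * c))⁻¹ * s ^ (-(1 / 2) : ℝ)) =
      ENNReal.ofReal (k * (2 * (Real.sqrt (4 * Real.pi * c))⁻¹) ^ (1 / 2 : ℝ) *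
        T ^ (1 / 4 : ℝ)) ^ 2 := by
  have hκ : 0 ≤ (Real.sqrt (4 * Real.pi * c))⁻¹ := by positivity
  set κ := (Real.sqrt (4 * Real.pi * c))⁻¹
  have h : ∀ s ∈ Ioi (0 : ℝ), cutoffProfile k 0 T s ^ 2 *
      ENNReal.ofReal (κ * s ^ (-(1 / 2) : ℝ)) = cutoffProfile (k ^ 2 * κ) (1 / 2) T s := by
    intro s hs
    by_cases hsT : s ∈ Iic T
    · rw [cutoffProfile, cutoffProfile, indicator_of_mem hsT, indicator_of_mem hsT, powerProfile,
        powerProfile, ENNReal.ofReal_mul hκ, ENNReal.ofReal_mul (by positivity),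
        ENNReal.ofReal_pow hk]
      simp [mul_assoc]
    · rw [cutoffProfile, cutoffProfile, indicator_of_notMem hsT, indicator_of_notMem hsT]
      simp
  rw [setLIntegral_congr_fun measurableSet_Ioi h,
    lintegral_cutoffProfile (by positivity) (by norm_num) hT, ← ENNReal.ofReal_pow (by positivity)]
  congr 1
  rw [mul_pow, mul_pow, ← Real.rpow_natCast, ← Real.rpow_natCast, ← Real.rpow_natCast,
    ← Real.rpow_mul (by positivity), ← Real.rpow_mul hT]
  norm_num
  exact Or.inl (by ring)

lemma lintegral_cutoffProfile_mul {k c T : ℝ} (hk : 0 ≤ k) (hc : 0 < c) (hT : 0 ≤ T) :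
    ∫⁻ s in Ioi 0, cutoffProfile k (1 / 2) T s *
      ENNReal.ofReal ((4 * Real.pi * c) ^ (-(1 / 4) : ℝ) * s ^ (-(1 / 4) : ℝ)) =
      ENNReal.ofReal (4 * k * (4 * Real.pi * c) ^ (-(1 / 4) : ℝ) * T ^ (1 / 4 : ℝ)) := by
  have hκ : 0 ≤ (4 * Real.pi * c) ^ (-(1 / 4) : ℝ) := by positivity
  set κ := (4 * Real.pi * c) ^ (-(1 / 4) : ℝ)
  have h : ∀ s ∈ Ioi (0 : ℝ), cutoffProfile k (1 / 2) T s *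
      ENNReal.ofReal (κ * s ^ (-(1 / 4) : ℝ)) = cutoffProfile (k * κ) (3 / 4) T s := by
    intro s hs
    have hs' : 0 < s := hs
    by_cases hsT : s ∈ Iic T
    · rw [cutoffProfile, cutoffProfile, indicator_of_mem hsT, indicator_of_mem hsT, powerProfile,
        powerProfile, ← ENNReal.ofReal_mul hk, ← ENNReal.ofReal_mul (by positivity),
        ← ENNReal.ofReal_mul (by positivity)]
      congr 1
      rw [show (-(3 / 4) : ℝ) = -(1 / 2) + -(1 / 4) by norm_num, Real.rpow_add hs']
      ring
    · rw [cutoffProfile, cutoffProfile, indicator_of_notMem hsT, indicator_of_notMem hsT, zero_mul]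
  rw [setLIntegral_congr_fun measurableSet_Ioi h,
    lintegral_cutoffProfile (by positivity) (by norm_num) hT]
  norm_num
  ring_nf

namespace IsDominated

variable {c T k α : ℝ} {u : ℝ → ℝ≥0∞} {N : ℝ × ℝ → ℝ × ℝ → ℝ} {f : ℝ × ℝ → ℝ}

lemma lintegral_enorm_mul_le_profile (h : IsDominated c T u N) (f : ℝ × ℝ → ℝ) (p : ℝ × ℝ) :
    ∫⁻ q, ‖N p q * f q‖ₑ ≤ ∫⁻ q, profileKernel c u p q * ‖f q‖ₑ :=
  lintegral_mono fun q => by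
    rw [enorm_mul]
    exact mul_le_mul_left (h.enorm_le p q) _

/-- `L² → L²` bound. -/
lemma lintegral_sq_le (hc : 0 < c) (hk : 0 ≤ k) (hα : α < 1) (hT : 0 ≤ T)
    (h : IsDominated c T (powerProfile k α) N) (hf : Measurable f) :
    ∫⁻ p, (∫⁻ q, ‖N p q * f q‖ₑ) ^ 2 ≤
      ENNReal.ofReal (k / (1 - α) * T ^ (1 - α)) ^ 2 * eLpNorm f 2 volume ^ 2 := by
  have hv := measurable_cutoffProfile k α T
  refine (lintegral_mono fun p =>
    pow_le_pow_left' (h.cutoff.lintegral_enorm_mul_le_profile f p) 2).trans ?_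
  rw [eLpNorm_two_sq]
  refine lintegral_sq_lintegral_mul_le (measurable_profileKernel c hv) hf.enorm ?_ ?_
  · exact fun p => (lintegral_profileKernel_right hc hv p).trans_le
      (lintegral_cutoffProfile hk hα hT).le
  · exact fun p => (lintegral_profileKernel_left hc hv p).trans_le
      (lintegral_cutoffProfile hk hα hT).le

/-- `L² → L^∞` bound, for a kernel of the size of the heat kernel. -/
lemma lintegral_le_eLpNorm (hc : 0 < c) (hk : 0 ≤ k) (hT : 0 ≤ T)
    (h : IsDominated c T (powerProfile k 0) N) (hf : Measurable f) (p : ℝ × ℝ) :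
    ∫⁻ q, ‖N p q * f q‖ₑ ≤
      ENNReal.ofReal (k * (2 * (Real.sqrt (4 * Real.pi * c))⁻¹) ^ (1 / 2 : ℝ) *
        T ^ (1 / 4 : ℝ)) * eLpNorm f 2 volume := by
  refine (h.cutoff.lintegral_enorm_mul_le_profile f p).trans
    ((ENNReal.pow_le_pow_left_iff two_ne_zero).1 ?_)
  refine (sq_lintegral_profileKernel_mul_le hc (measurable_cutoffProfile k 0 T) hf.enorm p).trans ?_
  rw [lintegral_cutoffProfile_sq_mul hk hc hT, mul_pow, eLpNorm_two_sq]

/-- `L^∞(L²) → L^∞` bound, for a kernel of the size of the derivative of the heat kernel. -/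
lemma lintegral_le_of_slice (hc : 0 < c) (hk : 0 ≤ k) (hT : 0 ≤ T)
    (h : IsDominated c T (powerProfile k (1 / 2)) N) (hf : Measurable f) {B : ℝ≥0∞}
    (hB : ∀ᵐ s : ℝ, eLpNorm (fun y => f (y, s)) 2 volume ≤ B) (p : ℝ × ℝ) :
    ∫⁻ q, ‖N p q * f q‖ₑ ≤
      ENNReal.ofReal (4 * k * (4 * Real.pi * c) ^ (-(1 / 4) : ℝ) * T ^ (1 / 4 : ℝ)) * B := by
  refine (h.cutoff.lintegral_enorm_mul_le_profile f p).trans ?_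
  rw [← lintegral_cutoffProfile_mul hk hc hT]
  refine lintegral_profileKernel_mul_le_of_slice hc (measurable_cutoffProfile _ _ _) hf.enorm ?_ p
  filter_upwards [hB] with s hs
  rw [← eLpNorm_two_sq]
  exact pow_le_pow_left' hs 2

end IsDominated

/-! ### Passing from the strip to the whole plane -/

lemma ae_ae_slice {P : ℝ × ℝ → Prop} (h : ∀ᵐ q : ℝ × ℝ, P q) : ∀ᵐ s : ℝ, ∀ᵐ y : ℝ, P (y, s) := by
  rw [Measure.volume_eq_prod] at h
  exact Measure.ae_ae_of_ae_prod (Measure.measurePreserving_swap.quasiMeasurePreserving.ae h)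

/-- A strongly measurable representative, extended by zero, of a function on the strip. -/
structure IsStripRep (T : ℝ) (f f' : ℝ × ℝ → ℝ) : Prop where
  measurable : Measurable f'
  eq_zero : ∀ q : ℝ × ℝ, q.2 ∉ Ioc 0 T → f' q = 0
  ae_eq : ∀ᵐ q : ℝ × ℝ, q.2 ∈ Ioc 0 T → f q = f' q

lemma exists_isStripRep {T : ℝ} {f : ℝ × ℝ → ℝ} (hf : AEStronglyMeasurable f (stripMeasure T)) :
    ∃ f', IsStripRep T f f' := by
  have hS : MeasurableSet ((univ : Set ℝ) ×ˢ Ioc (0 : ℝ) T) :=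
    MeasurableSet.univ.prod measurableSet_Ioc
  refine ⟨(univ ×ˢ Ioc 0 T).indicator (hf.mk f), hf.stronglyMeasurable_mk.measurable.indicator hS,
    fun q hq => indicator_of_notMem (fun h => hq h.2) _, ?_⟩
  have h := (ae_restrict_iff' hS).1 hf.ae_eq_mk
  filter_upwards [h] with q hq hqT
  rw [hq ⟨trivial, hqT⟩, indicator_of_mem (show q ∈ univ ×ˢ Ioc 0 T from ⟨trivial, hqT⟩)]

namespace IsStripRep

variable {c T : ℝ} {u : ℝ → ℝ≥0∞} {N : ℝ × ℝ → ℝ × ℝ → ℝ} {f f' : ℝ × ℝ → ℝ}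
  {G : ℝ → ℝ → ℝ → ℝ → ℝ}

lemma eLpNorm_eq (h : IsStripRep T f f') :
    eLpNorm f' 2 volume = eLpNorm f 2 (stripMeasure T) := by
  have hS : MeasurableSet ((univ : Set ℝ) ×ˢ Ioc (0 : ℝ) T) :=
    MeasurableSet.univ.prod measurableSet_Ioc
  rw [stripMeasure, ← eLpNorm_indicator_eq_eLpNorm_restrict hS]
  refine eLpNorm_congr_ae ?_
  filter_upwards [h.ae_eq] with q hq
  by_cases hqT : q.2 ∈ Ioc 0 T
  · rw [indicator_of_mem (show q ∈ univ ×ˢ Ioc 0 T from ⟨trivial, hqT⟩), hq hqT]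
  · rw [indicator_of_notMem fun h => hqT h.2, h.eq_zero q hqT]

lemma ae_eLpNorm_slice_le (h : IsStripRep T f f') :
    ∀ᵐ s : ℝ, eLpNorm (fun y => f' (y, s)) 2 volume ≤ normLinfL2 T f := by
  have h1 := ae_le_essSup (f := fun t : ℝ => eLpNorm (fun x : ℝ => f (x, t)) 2 volume)
    (μ := (volume : Measure ℝ).restrict (Ioo 0 T))
  rw [ae_restrict_iff' measurableSet_Ioo] at h1
  -- The mixed norm sees the open interval `(0,T)`, the representative lives on `(0,T]`; the slice
  -- at `T` is discarded.
  have h2 : ∀ᵐ s : ℝ, s ≠ T := by simp [ae_iff]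
  filter_upwards [h1, h2, ae_ae_slice h.ae_eq] with s hs hsT hae
  by_cases h0 : s ∈ Ioc 0 T
  · refine le_of_eq_of_le (eLpNorm_congr_ae ?_) (hs ⟨h0.1, lt_of_le_of_ne h0.2 hsT⟩)
    filter_upwards [hae] with y hy
    exact (hy h0).symm
  · have : (fun y => f' (y, s)) = 0 := funext fun y => h.eq_zero (y, s) h0
    rw [this, eLpNorm_zero]
    exact zero_le

lemma ae_mul_eq (h : IsStripRep T f f')
    (hG : ∀ x t ξ τ, 0 ≤ τ → τ < t → t ≤ T → N (x, t) (ξ, τ) = G x t ξ τ) {x t : ℝ} (ht : t ≤ T) :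
    ∀ᵐ q : ℝ × ℝ, q.2 ∈ Ioo 0 t → N (x, t) q * f' q = G x t q.1 q.2 * f q := by
  filter_upwards [h.ae_eq] with q hq hqt
  rw [hq ⟨hqt.1, hqt.2.le.trans ht⟩, ← hG x t q.1 q.2 hqt.1.le hqt.2 ht]

lemma mul_eq_zero (h : IsStripRep T f f') (hN : IsDominated c T u N) {x t : ℝ} {q : ℝ × ℝ}
    (hq : q.2 ∉ Ioo 0 t) : N (x, t) q * f' q = 0 := by
  by_cases h1 : q.2 < t
  · rw [h.eq_zero q fun h' => hq ⟨h'.1, h1⟩, mul_zero]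
  · rw [hN.eq_zero _ _ fun h' => h1 h'.2.1, zero_mul]

/-- Both sides are iterated integrals, so almost everywhere equality on slices suffices: the
identity holds at every point, even where the integral fails to converge absolutely. -/
lemma intervalIntegral_eq (h : IsStripRep T f f') (hN : IsDominated c T u N)
    (hG : ∀ x t ξ τ, 0 ≤ τ → τ < t → t ≤ T → N (x, t) (ξ, τ) = G x t ξ τ) {x t : ℝ} (h0 : 0 < t)
    (ht : t ≤ T) :
    ∫ τ in (0 : ℝ)..t, ∫ ξ : ℝ, G x t ξ τ * f (ξ, τ) =
      ∫ τ, ∫ ξ, N (x, t) (ξ, τ) * f' (ξ, τ) := by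
  rw [intervalIntegral.integral_of_le h0.le, integral_Ioc_eq_integral_Ioo,
    ← integral_indicator measurableSet_Ioo]
  refine integral_congr_ae ?_
  filter_upwards [ae_ae_slice (h.ae_mul_eq hG ht (x := x))] with τ hτ
  by_cases hτt : τ ∈ Ioo 0 t
  · rw [indicator_of_mem hτt]
    refine integral_congr_ae ?_
    filter_upwards [hτ] with ξ hξ
    exact (hξ hτt).symm
  · simp only [indicator_of_notMem hτt, h.mul_eq_zero hN (q := (_, τ)) hτt, integral_zero]

/-- The triangle inequality is applied in each integral separately, and Tonelli acts only on the
majorant. No convergence is assumed; if it fails, the right side is infinite. -/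
lemma enorm_intervalIntegral_le (h : IsStripRep T f f') (hN : IsDominated c T u N)
    (hG : ∀ x t ξ τ, 0 ≤ τ → τ < t → t ≤ T → N (x, t) (ξ, τ) = G x t ξ τ) {x t : ℝ} (h0 : 0 < t)
    (ht : t ≤ T) :
    ‖∫ τ in (0 : ℝ)..t, ∫ ξ : ℝ, G x t ξ τ * f (ξ, τ)‖ₑ ≤ ∫⁻ q, ‖N (x, t) q * f' q‖ₑ := by
  have hm := ((hN.measurable_right (x, t)).mul h.measurable).enorm
  rw [h.intervalIntegral_eq hN hG h0 ht, Measure.volume_eq_prod]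
  refine (enorm_integral_le_lintegral_enorm _).trans (le_of_le_of_eq
    (lintegral_mono fun τ => enorm_integral_le_lintegral_enorm _)
    (lintegral_prod_symm _ hm.aemeasurable).symm)

lemma integrable_mul (h : IsStripRep T f f') (hN : IsDominated c T u N) {p : ℝ × ℝ}
    (hp : ∫⁻ q, ‖N p q * f' q‖ₑ < ∞) : Integrable fun q => N p q * f' q :=
  ⟨((hN.measurable_right p).mul h.measurable).aestronglyMeasurable, hp⟩

lemma integrableOn (h : IsStripRep T f f') (hN : IsDominated c T u N)
    (hG : ∀ x t ξ τ, 0 ≤ τ → τ < t → t ≤ T → N (x, t) (ξ, τ) = G x t ξ τ) {x t : ℝ}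
    (ht : t ≤ T) (hfin : ∫⁻ q, ‖N (x, t) q * f' q‖ₑ < ∞) :
    IntegrableOn (fun q : ℝ × ℝ => G x t q.1 q.2 * f q) (univ ×ˢ Ioo 0 t) := by
  refine (h.integrable_mul hN hfin).integrableOn.congr ?_
  rw [Filter.EventuallyEq, ae_restrict_iff' (MeasurableSet.univ.prod measurableSet_Ioo)]
  filter_upwards [h.ae_mul_eq hG ht (x := x)] with q hq hqt
  exact hq hqt.2

lemma intervalIntegral_eq_integral (h : IsStripRep T f f') (hN : IsDominated c T u N)
    (hG : ∀ x t ξ τ, 0 ≤ τ → τ < t → t ≤ T → N (x, t) (ξ, τ) = G x t ξ τ) {x t : ℝ} (h0 : 0 < t)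
    (ht : t ≤ T) (hfin : ∫⁻ q, ‖N (x, t) q * f' q‖ₑ < ∞) :
    ∫ τ in (0 : ℝ)..t, ∫ ξ : ℝ, G x t ξ τ * f (ξ, τ) = ∫ q, N (x, t) q * f' q := by
  have hint := h.integrable_mul hN hfin
  rw [h.intervalIntegral_eq hN hG h0 ht]
  rw [Measure.volume_eq_prod] at hint ⊢
  exact (integral_prod_symm _ hint).symm

lemma measurable_lintegral_enorm_mul (h : IsStripRep T f f') (hN : IsDominated c T u N) :
    Measurable fun p => ∫⁻ q, ‖N p q * f' q‖ₑ := by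
  have hm : Measurable (fun z : (ℝ × ℝ) × (ℝ × ℝ) => ‖N z.1 z.2 * f' z.2‖ₑ) :=
    (hN.measurable.mul (h.measurable.comp measurable_snd)).enorm
  exact hm.lintegral_prod_right'

lemma ae_strip {P : ℝ × ℝ → Prop} (h : ∀ᵐ p : ℝ × ℝ, p.2 ∈ Ioc 0 T → P p) :
    ∀ᵐ p ∂(stripMeasure T), P p := by
  rw [stripMeasure, ae_restrict_iff' (MeasurableSet.univ.prod measurableSet_Ioc)]
  filter_upwards [h] with p hp hpT
  exact hp hpT.2

/-- The measurable representative is the joint integral over the plane; it agrees with the iterated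
one wherever absolute convergence gives Fubini. -/
lemma aestronglyMeasurable (h : IsStripRep T f f') (hN : IsDominated c T u N)
    (hG : ∀ x t ξ τ, 0 ≤ τ → τ < t → t ≤ T → N (x, t) (ξ, τ) = G x t ξ τ)
    (hfin : ∀ᵐ p, ∫⁻ q, ‖N p q * f' q‖ₑ < ∞) :
    AEStronglyMeasurable
      (fun p : ℝ × ℝ => ∫ τ in (0 : ℝ)..p.2, ∫ ξ : ℝ, G p.1 p.2 ξ τ * f (ξ, τ))
      (stripMeasure T) := by
  have hm : Measurable (fun z : (ℝ × ℝ) × (ℝ × ℝ) => N z.1 z.2 * f' z.2) :=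
    hN.measurable.mul (h.measurable.comp measurable_snd)
  refine ⟨fun p => ∫ q, N p q * f' q,
    hm.stronglyMeasurable.integral_prod_right' (ν := volume), ae_strip ?_⟩
  filter_upwards [hfin] with p hp hpT
  exact h.intervalIntegral_eq_integral hN hG hpT.1 hpT.2 hp

lemma eLpNorm_top_le (h : IsStripRep T f f') (hN : IsDominated c T u N)
    (hG : ∀ x t ξ τ, 0 ≤ τ → τ < t → t ≤ T → N (x, t) (ξ, τ) = G x t ξ τ) {B : ℝ≥0∞}
    (hB : ∀ p, ∫⁻ q, ‖N p q * f' q‖ₑ ≤ B) :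
    eLpNorm (fun p : ℝ × ℝ => ∫ τ in (0 : ℝ)..p.2, ∫ ξ : ℝ, G p.1 p.2 ξ τ * f (ξ, τ)) ∞
      (stripMeasure T) ≤ B := by
  rw [eLpNorm_exponent_top]
  refine eLpNormEssSup_le_of_ae_enorm_bound (ae_strip (Filter.Eventually.of_forall ?_))
  exact fun p hp => (h.enorm_intervalIntegral_le hN hG hp.1 hp.2).trans (hB p)

lemma eLpNorm_two_le (h : IsStripRep T f f') (hN : IsDominated c T u N)
    (hG : ∀ x t ξ τ, 0 ≤ τ → τ < t → t ≤ T → N (x, t) (ξ, τ) = G x t ξ τ) {B : ℝ≥0∞}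
    (hB : ∫⁻ p, (∫⁻ q, ‖N p q * f' q‖ₑ) ^ 2 ≤ B ^ 2) :
    eLpNorm (fun p : ℝ × ℝ => ∫ τ in (0 : ℝ)..p.2, ∫ ξ : ℝ, G p.1 p.2 ξ τ * f (ξ, τ)) 2
      (stripMeasure T) ≤ B := by
  refine (ENNReal.pow_le_pow_left_iff two_ne_zero).1 ?_
  rw [eLpNorm_two_sq]
  refine le_trans (lintegral_mono_ae (g := fun p => (∫⁻ q, ‖N p q * f' q‖ₑ) ^ 2)
    (ae_strip (Filter.Eventually.of_forall fun p hp => ?_)))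
    ((setLIntegral_le_lintegral _ _).trans hB)
  exact pow_le_pow_left' (h.enorm_intervalIntegral_le hN hG hp.1 hp.2) 2

lemma ae_lintegral_lt_top (h : IsStripRep T f f') (hN : IsDominated c T u N) {B : ℝ≥0∞}
    (hB : ∫⁻ p, (∫⁻ q, ‖N p q * f' q‖ₑ) ^ 2 ≤ B ^ 2) (hB_top : B ≠ ∞) :
    ∀ᵐ p, ∫⁻ q, ‖N p q * f' q‖ₑ < ∞ := by
  filter_upwards [ae_lt_top ((h.measurable_lintegral_enorm_mul hN).pow_const 2)
    (ne_top_of_le_ne_top (ENNReal.pow_ne_top hB_top) hB)] with p hp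
  exact (ENNReal.pow_lt_top_iff.1 hp).resolve_right two_ne_zero

end IsStripRep

/-! ### The composed coefficient and the final estimates -/

lemma holderCoeff_comp {m M T : ℝ} {L K : ℝ≥0} {g : ℝ → ℝ} {θ : ℝ × ℝ → ℝ}
    (hg : LipschitzWith L g) (hgm : ∀ z, m ≤ g z ∧ g z ≤ M)
    (hθ : HolderOnWith K (1 / 2) θ (univ ×ˢ Icc 0 T)) :
    HolderCoeff (fun p => g (θ p)) m M (L * K) T where
  lower p := (hgm _).1
  upper p := (hgm _).2
  holder p hp q hq := by
    rw [← Real.dist_eq, mul_assoc]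
    refine (hg.dist_le_mul _ _).trans (mul_le_mul_of_nonneg_left ?_ L.coe_nonneg)
    simpa using hθ.dist_le hp hq
  continuousOn := hg.continuous.comp_continuousOn (hθ.continuousOn (by norm_num))

end ParabolicKernel

theorem proposition4p2 (m M γ T₀ : ℝ) (L K : ℝ≥0) (hm : 0 < m) (hγ : 0 < γ) (hT₀ : 0 < T₀) :
    ∃ C : ℝ, ∀ T : ℝ, 0 < T → T ≤ T₀ →
      ∀ (g : ℝ → ℝ) (θ : ℝ × ℝ → ℝ),
        LipschitzWith L g → (∀ z, m ≤ g z ∧ g z ≤ M) →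
        HolderOnWith K (1 / 2) θ (univ ×ˢ Icc 0 T) →
        ParabolicKernel.WellDefined (fun p => g (θ p)) γ T ∧
        ∀ f : ℝ × ℝ → ℝ, MemLp f 2 (ParabolicKernel.stripMeasure T) →
          -- the integrals defining `M_f` and `M_{f,x}` converge absolutely
          (∀ x t : ℝ, 0 < t → t ≤ T →
            IntegrableOn (fun q : ℝ × ℝ =>
              ParabolicKernel.Gam (fun p => g (θ p)) γ x t q.1 q.2 * f q)
              (univ ×ˢ Ioo 0 t)) ∧
          (∀ᵐ p ∂(ParabolicKernel.stripMeasure T),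
            IntegrableOn (fun q : ℝ × ℝ =>
              ParabolicKernel.GamX (fun p => g (θ p)) γ p.1 p.2 q.1 q.2 * f q)
              (univ ×ˢ Ioo 0 p.2)) ∧
          AEStronglyMeasurable (ParabolicKernel.duhamel (fun p => g (θ p)) γ f)
            (ParabolicKernel.stripMeasure T) ∧
          AEStronglyMeasurable (ParabolicKernel.duhamelX (fun p => g (θ p)) γ f)
            (ParabolicKernel.stripMeasure T) ∧
          -- the four estimates
          eLpNorm (ParabolicKernel.duhamel (fun p => g (θ p)) γ f) ∞
              (ParabolicKernel.stripMeasure T) ≤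
            ENNReal.ofReal (C * T ^ (1 / 4 : ℝ)) *
              eLpNorm f 2 (ParabolicKernel.stripMeasure T) ∧
          eLpNorm (ParabolicKernel.duhamelX (fun p => g (θ p)) γ f) ∞
              (ParabolicKernel.stripMeasure T) ≤
            ENNReal.ofReal (C * T ^ (1 / 4 : ℝ)) * ParabolicKernel.normLinfL2 T f ∧
          eLpNorm (ParabolicKernel.duhamel (fun p => g (θ p)) γ f) 2
              (ParabolicKernel.stripMeasure T) ≤
            ENNReal.ofReal (C * T) * eLpNorm f 2 (ParabolicKernel.stripMeasure T) ∧
          eLpNorm (ParabolicKernel.duhamelX (fun p => g (θ p)) γ f) 2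
              (ParabolicKernel.stripMeasure T) ≤
            ENNReal.ofReal (C * Real.sqrt T) *
              eLpNorm f 2 (ParabolicKernel.stripMeasure T) := by
  open ParabolicKernel in
  -- If `m > M` no admissible `g` exists, and any constant serves.
  by_cases hmM : m ≤ M
  swap
  · exact ⟨0, fun T _ _ g θ _ hgm => absurd ((hgm 0).1.trans (hgm 0).2) hmM⟩
  have hc : 0 < 2 * M := by linarith
  obtain ⟨k, hk, hbounds⟩ := exists_kernelBounds (A := L * K) hm hmM (by positivity) hγ hT₀
  set C₁ := k * (2 * (Real.sqrt (4 * Real.pi * (2 * M)))⁻¹) ^ (1 / 2 : ℝ) with hC₁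
  set C₂ := 4 * k * (4 * Real.pi * (2 * M)) ^ (-(1 / 4) : ℝ) with hC₂
  have hC₁0 : 0 < C₁ := by positivity
  have hC₂0 : 0 < C₂ := by positivity
  -- `C₁` and `C₂` come from the two sup bounds; `2 * k` covers the Schur constants `k / (1 - α)`
  -- for `α = 0` and `α = 1/2`.
  refine ⟨C₁ + C₂ + 2 * k, fun T hT hTT₀ g θ hg hgm hθ => ?_⟩
  have hb := hbounds T hTT₀ _ (holderCoeff_comp hg hgm hθ)
  refine ⟨hb.wellDefined hc hk, fun f hf => ?_⟩
  obtain ⟨f', hrep⟩ := exists_isStripRep hf.1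
  have hf'_top : eLpNorm f' 2 volume ≠ ∞ := by rw [hrep.eLpNorm_eq]; exact hf.2.ne
  have hG : ∀ x t ξ τ, 0 ≤ τ → τ < t → t ≤ T → gamKernel (fun p => g (θ p)) γ T (x, t) (ξ, τ) =
      Gam (fun p => g (θ p)) γ x t ξ τ := fun x t ξ τ => hb.gamKernel_eq hc hk
  have hGX : ∀ x t ξ τ, 0 ≤ τ → τ < t → t ≤ T →
      gamKernelX (fun p => g (θ p)) γ T (x, t) (ξ, τ) =
      GamX (fun p => g (θ p)) γ x t ξ τ := fun x t ξ τ => hb.gamKernelX_eq hc hk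
  have hsup := hb.gam.lintegral_le_eLpNorm hc hk.le hT.le hrep.measurable
  have hsupX := hb.gamX.lintegral_le_of_slice hc hk.le hT.le hrep.measurable
    hrep.ae_eLpNorm_slice_le
  have hsq := hb.gam.lintegral_sq_le hc hk.le zero_lt_one hT.le hrep.measurable
  have hsqX := hb.gamX.lintegral_sq_le hc hk.le (by norm_num) hT.le hrep.measurable
  rw [← mul_pow] at hsq hsqX
  have hfin : ∀ p, ∫⁻ q, ‖gamKernel (fun p => g (θ p)) γ T p q * f' q‖ₑ < ∞ := fun p =>
    (hsup p).trans_lt (ENNReal.mul_ne_top ENNReal.ofReal_ne_top hf'_top).lt_top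
  -- For general `f` in `L²`, absolute convergence for `Γₓ` is read off the Schur bound, hence only
  -- at almost every point.
  have hfinX := hrep.ae_lintegral_lt_top hb.gamX hsqX
    (ENNReal.mul_ne_top ENNReal.ofReal_ne_top hf'_top)
  refine ⟨fun x t _ ht => hrep.integrableOn hb.gam hG ht (hfin _), IsStripRep.ae_strip ?_,
    hrep.aestronglyMeasurable hb.gam hG (Filter.Eventually.of_forall hfin),
    hrep.aestronglyMeasurable hb.gamX hGX hfinX,
    (hrep.eLpNorm_top_le hb.gam hG hsup).trans ?_,
    (hrep.eLpNorm_top_le hb.gamX hGX hsupX).trans ?_,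
    (hrep.eLpNorm_two_le hb.gam hG hsq).trans ?_,
    (hrep.eLpNorm_two_le hb.gamX hGX hsqX).trans ?_⟩
  · filter_upwards [hfinX] with p hp hpT
    exact hrep.integrableOn hb.gamX hGX hpT.2 hp
  · rw [hrep.eLpNorm_eq]
    gcongr
    linarith
  · gcongr
    linarith
  · rw [hrep.eLpNorm_eq, sub_zero, div_one, Real.rpow_one]
    gcongr
    linarith
  · rw [hrep.eLpNorm_eq, Real.sqrt_eq_rpow, show (1 : ℝ) - 1 / 2 = 1 / 2 by norm_num]
    gcongr
    linarith
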